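/- Let $\mathcal C$ be a non-degenerately braided fusion category over $\mathbb C$ with braiding $\beta$ (every simple object $x$ with $\beta_{y,x}\circ\beta_{x,y}=\mathrm{id}_{x\otimes y}$ for all $y$ is isomorphic to $1_{\mathcal C}$), and let $A\in\mathcal C$ be a connected étale algebra, i.e. a commutative separable algebra with $\dim\mathcal C(1_{\mathcal C}\to A)=1$. Notation. $\mathrm{Inv}(\mathcal C)$ is the group of isomorphism classes of invertible objects under $\otimes$, and $A'\cap\mathrm{Inv}(\mathcal C)$ is its subgroup of those $a$ with $\beta_{A,a}\circ\beta_{a,A}=\mathrm{id}_{a\otimes A}$. $\mathrm{Aut}_{\mathcal C}(A)$ is the group of algebra automorphisms of $A$. $\underline{\mathsf{Aut}}^{\mathsf{br}}_\otimes(\mathcal C)$ is the categorical group (monoidal category of 1-morphisms under composition) of $\mathbb C$-linear braided tensor autoequivalences $(\alpha,\psi)$ of $\mathcal C$ and monoidal natural isomorphisms. $\underline{\mathsf{Aut}}^{\mathsf{br}}_\otimes(\mathcal C|A)$ is the categorical group of triples $(\alpha,\psi,\lambda)$ with $(\alpha,\psi)\in\underline{\mathsf{Aut}}^{\mathsf{br}}_\otimes(\mathcal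 C)$ and $\lambda:\alpha(A)\to A$ an algebra isomorphism, with composition $(\alpha,\lambda)\circ(\gamma,\kappa)=(\alpha\circ\gamma,\lambda\circ\alpha(\kappa))$, whose 2-morphisms $(\alpha,\psi,\lambda)\Rightarrow(\gamma,\varphi,\kappa)$ are the monoidal natural isomorphisms $\eta:\alpha\Rightarrow\gamma$ with $\kappa\circ\eta_A=\lambda$. $\underline{\mathrm{Stab}}^{\mathsf{br}}_\otimes(A)\subset\underline{\mathsf{Aut}}^{\mathsf{br}}_\otimes(\mathcal C)$ is the full categorical subgroup of those $\alpha$ with $\alpha(A)\cong A$ as algebras. Removing the underline denotes the truncation $\pi_1$ (the group of isomorphism classes of 1-morphisms), and $\pi_2$ denotes the group of automorphisms of the identity 1-morphism. For $a\in\mathrm{Inv}(\mathcal C)$, the ring operator $\sigma^a\in\pi_2(\underline{\mathsf{Aut}}^{\mathsf{br}}_\otimes(\mathcal C))$ is the monoidal natural automorphism of $\mathrm{id}_{\mathcal C}$ determined by $\beta_{c,a}\circ\beta_{a,c}=\mathrm{id}_a\otimes\sigma^a_c$ for all $c\in\mathcal C$. Then: 1. $\sigma:\mathrm{Inv}(\mathcal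 C)\to\pi_2(\underline{\mathsf{Aut}}^{\mathsf{br}}_\otimes(\mathcal C))$, $a\mapsto\sigma^a$, is an isomorphism of groups, and it yields a group isomorphism $\pi_2(\underline{\mathsf{Aut}}^{\mathsf{br}}_\otimes(\mathcal C|A))\cong A'\cap\mathrm{Inv}(\mathcal C)$: there is a group isomorphism $e$ from the former to the latter such that $\sigma\circ e$ is the map on $\pi_2$ induced by forgetting $\lambda$. 2. The sequence of groups $$1\to A'\cap\mathrm{Inv}(\mathcal C)\hookrightarrow\mathrm{Inv}(\mathcal C)\xrightarrow{\ \sigma_A\ }\mathrm{Aut}_{\mathcal C}(A)\xrightarrow{\ [\mathrm{id}_{\mathcal C},\,\cdot\,]\ }\mathsf{Aut}^{\mathsf{br}}_\otimes(\mathcal C|A)\xrightarrow{\ F\ }\mathrm{Stab}^{\mathsf{br}}_\otimes(A)\to 1$$ is exact, where $\sigma_A(a)=\sigma^a_A$, the map $[\mathrm{id}_{\mathcal C},\,\cdot\,]$ sends $\lambda$ to the class of $(\mathrm{id}_{\mathcal C},\mathrm{id},\lambda)$, and $F$ is induced by the forgetful functor $(\alpha,\psi,\lambda)\mapsto(\alpha,\psi)$.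 -/

import Mathlib

open CategoryTheory MonoidalCategory
open scoped MonObj

universe v u

/-! ### Categorical groups, their truncation `π₁`, and `π₂` -/

namespace CatGrp

variable (G : Type u) [Category.{v} G] [MonoidalCategory G]

/-- A categorical group (a one-object 2-category whose 1-morphisms are invertible up to
2-morphisms and whose 2-morphisms are invertible), given as the monoidal category of its 1- and
2-morphisms: the tensor product is the composition of 1-morphisms. -/
class IsCategoricalGroup : Prop where
  isIso_hom : ∀ {X Y : G} (f : X ⟶ Y), IsIso f
  isUnit_obj : ∀ X : G, IsUnit (toSkeleton X)

/-- The truncation `π₁`: the isomorphism classes of 1-morphisms, with the multiplication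
induced by composition of 1-morphisms. -/
abbrev Pi1 : Type u := Skeleton G

noncomputable instance [IsCategoricalGroup G] : Group (Pi1 G) :=
  groupOfIsUnit fun a => by
    induction a using Quotient.inductionOn with
    | h X => exact IsCategoricalGroup.isUnit_obj X

theorem IsCategoricalGroup.of_leftInv (h₁ : ∀ {X Y : G} (f : X ⟶ Y), IsIso f)
    (h₂ : ∀ X : G, ∃ Y : G, Nonempty (Y ⊗ X ≅ 𝟙_ G)) : IsCategoricalGroup G where
  isIso_hom := h₁
  isUnit_obj X := by
    obtain ⟨Y, ⟨e⟩⟩ := h₂ X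
    obtain ⟨Z, ⟨f⟩⟩ := h₂ Y
    have hYX : toSkeleton Y * toSkeleton X = 1 := by
      rw [← Skeleton.toSkeleton_tensorObj, Skeleton.one_eq]; exact congr_toSkeleton_of_iso e
    have hZY : toSkeleton Z * toSkeleton Y = 1 := by
      rw [← Skeleton.toSkeleton_tensorObj, Skeleton.one_eq]; exact congr_toSkeleton_of_iso f
    exact ⟨⟨toSkeleton X, toSkeleton Y, left_inv_eq_right_inv hZY hYX ▸ hZY, hYX⟩, rfl⟩

/-- `π₂`: the automorphisms of the identity 1-morphism. -/
abbrev Pi2 : Type v := Aut (𝟙_ G)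

variable {G}
variable {H : Type*} [Category* H] [MonoidalCategory H]

/-- The map on truncations induced by a monoidal functor. -/
noncomputable def Pi1.map (F : G ⥤ H) [F.Monoidal] : Pi1 G →* Pi1 H :=
  Skeleton.monoidHom F

theorem Pi1.map_toSkeleton (F : G ⥤ H) [F.Monoidal] (X : G) :
    Pi1.map F (toSkeleton X) = toSkeleton (F.obj X) :=
  F.mapSkeleton_obj_toSkeleton X

/-- The map on `π₂` induced by a monoidal functor. -/
def Pi2.map (F : G ⥤ H) [F.Monoidal] : Pi2 G →* Pi2 H :=
  (Functor.Monoidal.εIso F).symm.conjAut.toMonoidHom.comp (F.mapAut (𝟙_ G))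

end CatGrp

open CatGrp

/-! ### Braided fusion categories -/

section Fusion

attribute [local instance] Abelian.hasFiniteBiproducts

/-- A fusion category over `ℂ`: a `ℂ`-linear abelian rigid monoidal category with bilinear tensor
product and finite-dimensional morphism spaces that is semisimple with finitely many
isomorphism classes of simple objects and whose unit object is simple. -/
class IsFusionCategory (C : Type u) [Category.{v} C] [Abelian C] [Linear ℂ C] [MonoidalCategory C]
    [MonoidalPreadditive C] [MonoidalLinear ℂ C] [RigidCategory C] : Prop where
  finiteDimensional_hom : ∀ X Y : C, FiniteDimensional ℂ (X ⟶ Y)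
  semisimple : ∀ X : C, ∃ (n : ℕ) (S : Fin n → C), (∀ i, Simple (S i)) ∧ Nonempty (X ≅ ⨁ S)
  finite_simples : ∃ (n : ℕ) (S : Fin n → C), ∀ X : C, Simple X → ∃ i, Nonempty (X ≅ S i)
  simple_unit : Simple (𝟙_ C)

variable {C : Type u} [Category.{v} C] [MonoidalCategory C] [BraidedCategory C]

/-- The double braiding `β_{c,a} ∘ β_{a,c}` on `a ⊗ c`. -/
def monodromy (a c : C) : a ⊗ c ⟶ a ⊗ c := (β_ a c).hom ≫ (β_ c a).hom

/-- `a` and `c` are transparent to each other (they centralize each other). -/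
def Transparent (a c : C) : Prop := monodromy a c = 𝟙 (a ⊗ c)

variable (C) in
/-- A non-degenerate braiding: the Müger center is trivial, i.e. the only simple object that is
transparent to every object is the unit. -/
class IsNondegenerate [Abelian C] : Prop where
  iso_unit : ∀ X : C, Simple X → (∀ Y : C, Transparent X Y) → Nonempty (X ≅ 𝟙_ C)

/-- A connected étale algebra: commutative, separable (the multiplication is split by a map of
bimodules), and with one-dimensional space of morphisms from the unit object. -/
class IsConnectedEtale [Abelian C] [Linear ℂ C] (A : Mon C) : Prop where
  commutative : (β_ A.X A.X).hom ≫ μ[A.X] = μ[A.X]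
  separable : ∃ s : A.X ⟶ A.X ⊗ A.X, s ≫ μ[A.X] = 𝟙 A.X ∧
    μ[A.X] ≫ s = A.X ◁ s ≫ (α_ A.X A.X A.X).inv ≫ μ[A.X] ▷ A.X ∧
    μ[A.X] ≫ s = s ▷ A.X ≫ (α_ A.X A.X A.X).hom ≫ A.X ◁ μ[A.X]
  connected : Module.finrank ℂ (𝟙_ C ⟶ A.X) = 1

end Fusion

/-! ### The categorical group of braided autoequivalences -/

/-- A braided tensor autoequivalence `(α, ψ)` (with `α` linear). -/
structure BrAut (C : Type u) [Category.{v} C] [Abelian C] [Linear ℂ C] [MonoidalCategory C]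
    [BraidedCategory C] where
  functor : C ⥤ C
  [braided : functor.Braided]
  [additive : functor.Additive]
  [linear : functor.Linear ℂ]
  [isEquivalence : functor.IsEquivalence]

namespace BrAut

theorem inverse_isMonoidal {C D : Type*} [Category* C] [MonoidalCategory C]
    [Category* D] [MonoidalCategory D] (e : C ≌ D) [e.functor.Monoidal] :
    letI := e.inverseMonoidal
    e.IsMonoidal := by
  let := e.toAdjunction.rightAdjointLaxMonoidal
  have h : e.toAdjunction.IsMonoidal := inferInstance
  exact h

theorem inverse_braided {C D : Type*} [Category* C] [MonoidalCategory C] [BraidedCategory C]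
    [Category* D] [MonoidalCategory D] [BraidedCategory D]
    (e : C ≌ D) [e.functor.Braided] [e.inverse.Monoidal] [e.IsMonoidal] (X Y : D) :
    Functor.LaxMonoidal.μ e.inverse X Y ≫ e.inverse.map (β_ X Y).hom =
      (β_ (e.inverse.obj X) (e.inverse.obj Y)).hom ≫ Functor.LaxMonoidal.μ e.inverse Y X := by
  apply e.functor.map_injective
  rw [← cancel_mono (e.counitIso.hom.app (Y ⊗ X))]
  have h := e.counitIso.hom.naturality (β_ X Y).hom
  dsimp only [Functor.comp_map, Functor.id_map, Functor.comp_obj, Functor.id_obj] at h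
  rw [Functor.map_comp, Functor.map_comp, Category.assoc, Category.assoc, h,
    e.functor_map_μ_inverse_comp_counitIso_hom_app_tensor_assoc,
    e.functor_map_μ_inverse_comp_counitIso_hom_app_tensor, Functor.map_braiding]
  simp

attribute [instance] braided additive linear isEquivalence

variable {C : Type u} [Category.{v} C] [Abelian C] [Linear ℂ C] [MonoidalCategory C]
  [BraidedCategory C]

/-- 2-morphisms: monoidal natural isomorphisms. -/
@[ext]
structure Hom (F G : BrAut C) where
  iso : F.functor ≅ G.functor
  isMonoidal : NatTrans.IsMonoidal iso.hom := by infer_instance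

attribute [instance] Hom.isMonoidal

instance : Category (BrAut C) where
  Hom := Hom
  id F := ⟨Iso.refl F.functor, inferInstanceAs (NatTrans.IsMonoidal (𝟙 _))⟩
  comp f g := ⟨f.iso ≪≫ g.iso, inferInstanceAs (NatTrans.IsMonoidal (f.iso.hom ≫ g.iso.hom))⟩

@[ext]
theorem hom_ext {F G : BrAut C} {f g : F ⟶ G}
    (h : ∀ X : C, f.iso.hom.app X = g.iso.hom.app X) : f = g :=
  Hom.ext (Iso.ext (NatTrans.ext (funext h)))

@[simp] theorem id_app (F : BrAut C) (X : C) :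
    (Hom.iso (𝟙 F)).hom.app X = 𝟙 (F.functor.obj X) := rfl

@[simp] theorem comp_app {F G H : BrAut C} (f : F ⟶ G) (g : G ⟶ H) (X : C) :
    (f ≫ g).iso.hom.app X = f.iso.hom.app X ≫ g.iso.hom.app X := rfl

/-- The inverse 2-morphism. -/
def homSymm {F G : BrAut C} (f : F ⟶ G) : G ⟶ F :=
  Hom.mk f.iso.symm (inferInstanceAs (NatTrans.IsMonoidal f.iso.inv))

/-- An isomorphism in the category of 1-morphisms from a 2-morphism. -/
@[simps]
def isoOfHom {F G : BrAut C} (f : F ⟶ G) : F ≅ G where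
  hom := f
  inv := homSymm f
  hom_inv_id := by ext X; exact f.iso.hom_inv_id_app X
  inv_hom_id := by ext X; exact f.iso.inv_hom_id_app X

/-- The tensor product `F ⊗ G` is the composite `F ∘ G` (first `G`, then `F`). -/
instance : MonoidalCategoryStruct (BrAut C) where
  tensorObj F G := ⟨G.functor ⋙ F.functor⟩
  tensorUnit := ⟨𝟭 C⟩
  whiskerLeft F _ _ g := Hom.mk (Functor.isoWhiskerRight g.iso F.functor)
    (inferInstanceAs (NatTrans.IsMonoidal (Functor.whiskerRight g.iso.hom F.functor)))
  whiskerRight f G := Hom.mk (Functor.isoWhiskerLeft G.functor f.iso)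
    (inferInstanceAs (NatTrans.IsMonoidal (Functor.whiskerLeft G.functor f.iso.hom)))
  associator F G H := isoOfHom (Hom.mk (Functor.associator H.functor G.functor F.functor).symm
    (inferInstanceAs (NatTrans.IsMonoidal
      (Functor.associator H.functor G.functor F.functor).inv)))
  leftUnitor F := isoOfHom (Hom.mk F.functor.rightUnitor inferInstance)
  rightUnitor F := isoOfHom (Hom.mk F.functor.leftUnitor inferInstance)

@[simp] theorem tensorObj_functor (F G : BrAut C) : (F ⊗ G).functor = G.functor ⋙ F.functor := rfl

@[simp] theorem tensorUnit_functor : (𝟙_ (BrAut C)).functor = 𝟭 C := rfl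

@[simp] theorem whiskerLeft_app (F : BrAut C) {G H : BrAut C} (g : G ⟶ H) (X : C) :
    (F ◁ g).iso.hom.app X = F.functor.map (g.iso.hom.app X) := rfl

@[simp] theorem whiskerRight_app {F G : BrAut C} (f : F ⟶ G) (H : BrAut C) (X : C) :
    (f ▷ H).iso.hom.app X = f.iso.hom.app (H.functor.obj X) := rfl

theorem tensorHom_eq {F G H K : BrAut C} (f : F ⟶ G) (g : H ⟶ K) :
    f ⊗ₘ g = f ▷ H ≫ G ◁ g := rfl

@[simp] theorem associator_hom_app (F G H : BrAut C) (X : C) :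
    (α_ F G H).hom.iso.hom.app X = 𝟙 (F.functor.obj (G.functor.obj (H.functor.obj X))) := rfl

@[simp] theorem leftUnitor_hom_app (F : BrAut C) (X : C) :
    (λ_ F).hom.iso.hom.app X = 𝟙 (F.functor.obj X) := rfl

@[simp] theorem rightUnitor_hom_app (F : BrAut C) (X : C) :
    (ρ_ F).hom.iso.hom.app X = 𝟙 (F.functor.obj X) := rfl

instance : MonoidalCategory (BrAut C) :=
  MonoidalCategory.ofTensorHom
    (id_tensorHom_id := fun F G => by ext X; simp [tensorHom_eq])
    (tensorHom_comp_tensorHom := fun f₁ f₂ g₁ g₂ => by ext X; simp [tensorHom_eq])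
    (id_tensorHom := fun F _ _ g => by ext X; simp [tensorHom_eq])
    (tensorHom_id := fun f G => by ext X; simp [tensorHom_eq])
    (associator_naturality := fun f g h => by ext X; simp [tensorHom_eq])
    (leftUnitor_naturality := fun f => by ext X; simp [tensorHom_eq])
    (rightUnitor_naturality := fun f => by ext X; simp [tensorHom_eq])
    (pentagon := fun F G H K => by ext X; simp [tensorHom_eq])
    (triangle := fun F G => by ext X; simp [tensorHom_eq])

/-- The inverse functor, with its inverse monoidal structure. -/
noncomputable def inverse (F : BrAut C) : BrAut C :=
  letI e := F.functor.asEquivalence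
  letI : e.functor.Braided := F.braided
  letI : e.inverse.Monoidal := e.inverseMonoidal
  haveI : e.IsMonoidal := inverse_isMonoidal e
  letI : e.functor.Additive := F.additive
  letI : e.functor.Linear ℂ := F.linear
  letI : e.inverse.Braided := { braided := inverse_braided e }
  ⟨e.inverse⟩

/-- `F⁻¹ ∘ F` is isomorphic to the identity. -/
noncomputable def inverseTensorIso (F : BrAut C) : F.inverse ⊗ F ≅ 𝟙_ (BrAut C) :=
  letI e := F.functor.asEquivalence
  letI : e.functor.Braided := F.braided
  letI : e.inverse.Monoidal := e.inverseMonoidal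
  haveI : e.IsMonoidal := inverse_isMonoidal e
  haveI : NatTrans.IsMonoidal e.unitIso.hom := inferInstanceAs (NatTrans.IsMonoidal e.unit)
  isoOfHom (Hom.mk e.unitIso.symm
    (inferInstanceAs (NatTrans.IsMonoidal e.unitIso.inv)))

instance : IsCategoricalGroup (BrAut C) :=
  .of_leftInv _ (fun f => (isoOfHom f).isIso_hom) fun F => ⟨F.inverse, ⟨F.inverseTensorIso⟩⟩

end BrAut

/-! ### Automorphisms together with an algebra isomorphism, and stabilizers -/

section Over

variable {C : Type u} [Category.{v} C] [Abelian C] [Linear ℂ C] [MonoidalCategory C]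
  [BraidedCategory C]

/-- Triples `(α, ψ, λ)`: a braided autoequivalence `(α, ψ)` with an algebra isomorphism
`λ : α(A) → A`, where `α(A)` has multiplication `α(m) ∘ ψ` and unit `α(i)`. -/
structure BrAutOver (A : Mon C) where
  aut : BrAut C
  algIso : aut.functor.mapMon.obj A ≅ A

namespace BrAutOver

variable {A : Mon C}

/-- The underlying morphism of the algebra isomorphism. -/
def lam (F : BrAutOver A) : F.aut.functor.obj A.X ⟶ A.X := F.algIso.hom.hom

/-- 2-morphisms `(α, ψ, λ) ⇒ (γ, φ, κ)`: monoidal natural isomorphisms `η` with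
`κ ∘ η_A = λ`. -/
@[ext]
structure Hom (F G : BrAutOver A) where
  toHom : F.aut ⟶ G.aut
  comm : toHom.iso.hom.app A.X ≫ G.lam = F.lam

instance : Category (BrAutOver A) where
  Hom := Hom
  id F := ⟨𝟙 F.aut, by simp⟩
  comp f g := ⟨f.toHom ≫ g.toHom, by simp [Hom.comm]⟩

/-- An isomorphism from a 2-morphism. -/
@[simps]
def isoOfHom {F G : BrAutOver A} (f : Hom F G) : F ≅ G where
  hom := f
  inv := Hom.mk (BrAut.homSymm f.toHom) (by
    rw [← f.comm]; exact f.toHom.iso.inv_hom_id_app_assoc _ _)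
  hom_inv_id := Hom.ext (BrAut.isoOfHom f.toHom).hom_inv_id
  inv_hom_id := Hom.ext (BrAut.isoOfHom f.toHom).inv_hom_id

/-- The composite `(α, λ) ∘ (γ, κ) = (α ∘ γ, λ ∘ α(κ))`. -/
def comp (F G : BrAutOver A) : BrAutOver A where
  aut := F.aut ⊗ G.aut
  algIso := Functor.mapMonCompIso.app A ≪≫ F.aut.functor.mapMon.mapIso G.algIso ≪≫ F.algIso

theorem comp_lam (F G : BrAutOver A) :
    (F.comp G).lam = F.aut.functor.map G.lam ≫ F.lam :=
  Category.id_comp _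

/-- The triple `(id, id, l)` for an algebra automorphism `l` of `A`. -/
def ofAut (l : Aut A) : BrAutOver A where
  aut := 𝟙_ (BrAut C)
  algIso := Functor.mapMonIdIso.app A ≪≫ l

theorem ofAut_lam (l : Aut A) : (ofAut l).lam = l.hom.hom :=
  Category.id_comp _

instance : MonoidalCategoryStruct (BrAutOver A) where
  tensorObj F G := F.comp G
  tensorUnit := ofAut 1
  whiskerLeft F _ _ g := Hom.mk (F.aut ◁ g.toHom) (by
    rw [comp_lam, comp_lam, ← g.comm, Functor.map_comp_assoc]; rfl)
  whiskerRight f G := Hom.mk (f.toHom ▷ G.aut) (by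
    rw [comp_lam, comp_lam, ← f.comm]; exact (f.toHom.iso.hom.naturality_assoc _ _).symm)
  associator F G H := isoOfHom (Hom.mk (α_ F.aut G.aut H.aut).hom (by
    rw [comp_lam, comp_lam, comp_lam, comp_lam]
    exact (Category.id_comp _).trans
      ((congrArg (· ≫ F.lam) (F.aut.functor.map_comp _ _)).trans (Category.assoc _ _ _))))
  leftUnitor F := isoOfHom (Hom.mk (λ_ F.aut).hom (by
    rw [comp_lam, ofAut_lam]; exact (Category.id_comp _).trans (Category.comp_id _).symm))
  rightUnitor F := isoOfHom (Hom.mk (ρ_ F.aut).hom (by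
    rw [comp_lam, ofAut_lam]
    exact congrArg (· ≫ F.lam) (F.aut.functor.map_id A.X).symm))

instance : MonoidalCategory (BrAutOver A) where
  tensorHom_def f g := Hom.ext (tensorHom_def f.toHom g.toHom)
  id_tensorHom_id F G := Hom.ext (id_tensorHom_id F.aut G.aut)
  tensorHom_comp_tensorHom f₁ f₂ g₁ g₂ :=
    Hom.ext (tensorHom_comp_tensorHom f₁.toHom f₂.toHom g₁.toHom g₂.toHom)
  whiskerLeft_id F G := Hom.ext (whiskerLeft_id F.aut G.aut)
  id_whiskerRight F G := Hom.ext (id_whiskerRight F.aut G.aut)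
  associator_naturality f g h := Hom.ext (associator_naturality f.toHom g.toHom h.toHom)
  leftUnitor_naturality f := Hom.ext (leftUnitor_naturality f.toHom)
  rightUnitor_naturality f := Hom.ext (rightUnitor_naturality f.toHom)
  pentagon F G H K := Hom.ext (pentagon F.aut G.aut H.aut K.aut)
  triangle F G := Hom.ext (triangle F.aut G.aut)

theorem isIso_hom {F G : BrAutOver A} (f : F ⟶ G) : IsIso f := (isoOfHom f).isIso_hom

/-- The inverse `(α⁻¹, α⁻¹(λ⁻¹))`. -/
noncomputable def inverse (F : BrAutOver A) : BrAutOver A where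
  aut := F.aut.inverse
  algIso := F.aut.inverse.functor.mapMon.mapIso F.algIso.symm ≪≫ Functor.mapMonCompIso.symm.app A ≪≫
    (Functor.mapMonNatIso F.aut.inverseTensorIso.hom.iso).app A ≪≫ Functor.mapMonIdIso.app A

theorem inverse_comp_lam (F : BrAutOver A) :
    (F.inverse.comp F).lam = F.aut.inverseTensorIso.hom.iso.hom.app A.X := by
  have h : F.aut.inverse.functor.map F.lam ≫ F.aut.inverse.functor.map F.algIso.inv.hom =
      𝟙 _ := by
    rw [← Functor.map_comp]
    exact (congrArg (fun t => F.aut.inverse.functor.map (Mon.Hom.hom t)) F.algIso.hom_inv_id).trans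
      (F.aut.inverse.functor.map_id _)
  have h' : F.inverse.lam = F.aut.inverse.functor.map F.algIso.inv.hom ≫
      F.aut.inverseTensorIso.hom.iso.hom.app A.X :=
    congrArg (F.aut.inverse.functor.map F.algIso.inv.hom ≫ ·)
      ((Category.id_comp _).trans (Category.comp_id _))
  rw [comp_lam, h']
  exact (Category.assoc _ _ _).symm.trans
    ((congrArg (· ≫ F.aut.inverseTensorIso.hom.iso.hom.app A.X) h).trans (Category.id_comp _))

instance : IsCategoricalGroup (BrAutOver A) :=
  .of_leftInv _ isIso_hom fun F => ⟨F.inverse, ⟨isoOfHom (Hom.mk F.aut.inverseTensorIso.hom 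
    ((congrArg (F.aut.inverseTensorIso.hom.iso.hom.app A.X ≫ ·) (ofAut_lam 1)).trans
      ((Category.comp_id _).trans F.inverse_comp_lam.symm)))⟩⟩

variable (A) in
/-- The monoidal functor forgetting the algebra isomorphism. -/
def forget : BrAutOver A ⥤ BrAut C where
  obj F := F.aut
  map f := f.toHom

variable (A) in
def forgetCore : (forget A).CoreMonoidal :=
    { εIso := Iso.refl _
      μIso := fun _ _ => Iso.refl _
      μIso_hom_natural_left := fun _ _ => (Category.comp_id _).trans (Category.id_comp _).symm
      μIso_hom_natural_right := fun _ _ => (Category.comp_id _).trans (Category.id_comp _).symm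
      associativity := fun F G H =>
        have h : 𝟙 (F.aut ⊗ G.aut) ▷ H.aut ≫ 𝟙 ((F.aut ⊗ G.aut) ⊗ H.aut) ≫
            (α_ F.aut G.aut H.aut).hom = (α_ F.aut G.aut H.aut).hom ≫
            F.aut ◁ 𝟙 (G.aut ⊗ H.aut) ≫ 𝟙 (F.aut ⊗ G.aut ⊗ H.aut) := by simp
        h
      left_unitality := fun F =>
        have h : (λ_ F.aut).hom = 𝟙 (𝟙_ (BrAut C)) ▷ F.aut ≫ 𝟙 (𝟙_ (BrAut C) ⊗ F.aut) ≫
            (λ_ F.aut).hom := by simp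
        h
      right_unitality := fun F =>
        have h : (ρ_ F.aut).hom = F.aut ◁ 𝟙 (𝟙_ (BrAut C)) ≫ 𝟙 (F.aut ⊗ 𝟙_ (BrAut C)) ≫
            (ρ_ F.aut).hom := by simp
        h }

instance : (forget A).Monoidal := (forgetCore A).toMonoidal

end BrAutOver

variable (A : Mon C)

/-- The condition that `α(A)` and `A` are isomorphic as algebras. -/
def stabilizes : ObjectProperty (BrAut C) := fun F => Nonempty (F.functor.mapMon.obj A ≅ A)

instance : (stabilizes A).IsMonoidal where
  prop_unit := ⟨(BrAutOver.ofAut (1 : Aut A)).algIso⟩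
  prop_tensor F G := fun ⟨f⟩ ⟨g⟩ => ⟨(BrAutOver.comp ⟨F, f⟩ ⟨G, g⟩).algIso⟩

/-- The stabilizer of the algebra `A`: the full categorical subgroup of braided
autoequivalences `α` for which there is an algebra isomorphism `α(A) ≅ A`. -/
abbrev Stab := (stabilizes A).FullSubcategory

theorem Stab.isIso_hom {F G : Stab A} (f : F ⟶ G) : IsIso f :=
  ((stabilizes A).isoMk (BrAut.isoOfHom f.hom)).isIso_hom

instance : IsCategoricalGroup (Stab A) :=
  .of_leftInv _ (Stab.isIso_hom A) fun F =>
    ⟨⟨F.obj.inverse, F.property.elim fun f => ⟨(BrAutOver.inverse ⟨F.obj, f⟩).algIso⟩⟩,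
      ⟨(stabilizes A).isoMk F.obj.inverseTensorIso⟩⟩

/-- The forgetful monoidal functor `(α, ψ, λ) ↦ (α, ψ)` onto the stabilizer. -/
def toStab : BrAutOver A ⥤ Stab A :=
  (stabilizes A).lift (BrAutOver.forget A) fun F => ⟨F.algIso⟩

instance : (toStab A).Monoidal :=
  Functor.CoreMonoidal.toMonoidal
    { εIso := Iso.refl _
      μIso := fun _ _ => Iso.refl _
      μIso_hom_natural_left := fun _ _ => (Category.comp_id _).trans (Category.id_comp _).symm
      μIso_hom_natural_right := fun _ _ => (Category.comp_id _).trans (Category.id_comp _).symm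
      associativity := fun F G H =>
        (stabilizes A).ι.map_injective
          (Functor.CoreMonoidal.associativity (BrAutOver.forgetCore A) F G H)
      left_unitality := fun F =>
        (stabilizes A).ι.map_injective
          (Functor.CoreMonoidal.left_unitality (BrAutOver.forgetCore A) F)
      right_unitality := fun F =>
        (stabilizes A).ι.map_injective
          (Functor.CoreMonoidal.right_unitality (BrAutOver.forgetCore A) F) }

end Over

/-! ### Invertible objects and ring operators -/

section Ring

variable {C : Type u} [Category.{v} C] [MonoidalCategory C]

variable (C) in
/-- The group of isomorphism classes of invertible objects, with multiplication induced by the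
tensor product. -/
abbrev InvObj : Type u := (Skeleton C)ˣ

/-- A representative of an isomorphism class of invertible objects. -/
noncomputable def InvObj.obj (a : InvObj C) : C := (fromSkeleton C).obj (a : Skeleton C)

theorem InvObj.toSkeleton_obj (a : InvObj C) : toSkeleton a.obj = (a : Skeleton C) :=
  toSkeleton_fromSkeleton_obj _

theorem isEquivalence_tensorLeft {a b : C} (e : a ⊗ b ≅ 𝟙_ C) (f : b ⊗ a ≅ 𝟙_ C) :
    (tensorLeft a).IsEquivalence :=
  Equivalence.isEquivalence_functor (CategoryTheory.Equivalence.mk (tensorLeft a) (tensorLeft b)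
    (NatIso.ofComponents (fun X => (λ_ X).symm ≪≫ whiskerRightIso f.symm X ≪≫ α_ b a X)
      (by
        intro X Y g
        have h := whisker_exchange_assoc f.inv g (α_ b a Y).hom
        simp only [tensor_whiskerLeft, id_whiskerLeft] at h
        simp at h ⊢
        rw [← h]; simp))
    (NatIso.ofComponents (fun X => (α_ a b X).symm ≪≫ whiskerRightIso e X ≪≫ λ_ X)
      (by
        intro X Y g
        have h := whisker_exchange_assoc e.hom g (λ_ Y).hom
        simp at h ⊢
        rw [← h]; simp)))

theorem InvObj.isEquivalence_tensorLeft (a : InvObj C) : (tensorLeft a.obj).IsEquivalence := by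
  have h₁ : toSkeleton (a.obj ⊗ (a⁻¹).obj) = toSkeleton (𝟙_ C) := by
    rw [Skeleton.toSkeleton_tensorObj, toSkeleton_obj, toSkeleton_obj, Units.mul_inv]; rfl
  have h₂ : toSkeleton ((a⁻¹).obj ⊗ a.obj) = toSkeleton (𝟙_ C) := by
    rw [Skeleton.toSkeleton_tensorObj, toSkeleton_obj, toSkeleton_obj, Units.inv_mul]; rfl
  exact _root_.isEquivalence_tensorLeft (Skeleton.isoOfEq h₁) (Skeleton.isoOfEq h₂)

theorem InvObj.whiskerLeft_injective (a : InvObj C) {c d : C} {f g : c ⟶ d}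
    (h : a.obj ◁ f = a.obj ◁ g) : f = g := by
  have := a.isEquivalence_tensorLeft
  exact (tensorLeft a.obj).map_injective h

variable [BraidedCategory C]

theorem monodromy_naturality_right (a : C) {c d : C} (f : c ⟶ d) :
    a ◁ f ≫ monodromy a d = monodromy a c ≫ a ◁ f := by
  simp [monodromy]

theorem monodromy_naturality_left {a b : C} (f : a ⟶ b) (c : C) :
    f ▷ c ≫ monodromy b c = monodromy a c ≫ f ▷ c := by
  simp [monodromy]

theorem monodromy_tensor_right (a c d : C) :
    monodromy a (c ⊗ d) = (α_ a c d).inv ≫ (β_ a c).hom ▷ d ≫ (α_ c a d).hom ≫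
      c ◁ monodromy a d ≫ (α_ c a d).inv ≫ (β_ c a).hom ▷ d ≫ (α_ a c d).hom := by
  simp [monodromy, BraidedCategory.braiding_tensor_right_hom,
    BraidedCategory.braiding_tensor_left_hom]

theorem monodromy_tensor_left (a b c : C) :
    monodromy (a ⊗ b) c = (α_ a b c).hom ≫ a ◁ (β_ b c).hom ≫ (α_ a c b).inv ≫
      monodromy a c ▷ b ≫ (α_ a c b).hom ≫ a ◁ (β_ c b).hom ≫ (α_ a b c).inv := by
  simp [monodromy, BraidedCategory.braiding_tensor_right_hom,
    BraidedCategory.braiding_tensor_left_hom]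

instance (a c : C) : IsIso (monodromy a c) := by unfold monodromy; infer_instance

theorem Transparent.of_iso {a b : C} (e : a ≅ b) {c : C} (h : Transparent a c) :
    Transparent b c := by
  have := monodromy_naturality_left e.inv c
  rw [show monodromy a c = 𝟙 _ from h, Category.comp_id] at this
  rw [Transparent, ← cancel_mono (e.inv ▷ c), Category.id_comp, ← this]

/-- The component at `c` of the ring operator of an invertible object `a`: the unique morphism
`σ : c ⟶ c` such that `id_a ⊗ σ` is the double braiding of `a` and `c`. -/
noncomputable def ringIso (a : InvObj C) (c : C) : c ≅ c :=
  haveI := a.isEquivalence_tensorLeft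
  (tensorLeft a.obj).preimageIso (asIso (monodromy a.obj c))

theorem whiskerLeft_ringIso_obj (a : InvObj C) (c : C) :
    a.obj ◁ (ringIso a c).hom = monodromy a.obj c := by
  have := a.isEquivalence_tensorLeft
  exact (tensorLeft a.obj).map_preimage _

theorem whiskerLeft_ringIso (a : InvObj C) {x : C} (hx : toSkeleton x = (a : Skeleton C)) (c : C) :
    x ◁ (ringIso a c).hom = monodromy x c := by
  obtain e : x ≅ a.obj := Skeleton.isoOfEq (hx.trans a.toSkeleton_obj.symm)
  rw [← cancel_mono (e.hom ▷ c), whisker_exchange, whiskerLeft_ringIso_obj,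
    monodromy_naturality_left]

theorem ringIso_naturality (a : InvObj C) {c d : C} (f : c ⟶ d) :
    f ≫ (ringIso a d).hom = (ringIso a c).hom ≫ f := by
  apply a.whiskerLeft_injective
  simp only [MonoidalCategory.whiskerLeft_comp, whiskerLeft_ringIso_obj, monodromy_naturality_right]

theorem ringIso_tensor (a : InvObj C) (c d : C) :
    (ringIso a (c ⊗ d)).hom = (ringIso a c).hom ⊗ₘ (ringIso a d).hom := by
  apply a.whiskerLeft_injective
  rw [whiskerLeft_ringIso_obj, monodromy_tensor_right, ← whiskerLeft_ringIso_obj a d, MonoidalCategory.tensorHom_def,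
    MonoidalCategory.whiskerLeft_comp]
  have h : a.obj ◁ (ringIso a c).hom ▷ d = (α_ a.obj c d).inv ≫
      monodromy a.obj c ▷ d ≫ (α_ a.obj c d).hom := by
    rw [← whiskerLeft_ringIso_obj]; simp
  rw [h]
  have h₂ := whisker_exchange (β_ c a.obj).hom (ringIso a d).hom =≫ (α_ a.obj c d).hom
  simp only [tensor_whiskerLeft, Category.assoc, Iso.inv_hom_id, Category.comp_id] at h₂
  simp [monodromy, h₂]

theorem ringIso_unit (a : InvObj C) : (ringIso a (𝟙_ C)).hom = 𝟙 (𝟙_ C) := by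
  apply a.whiskerLeft_injective
  rw [whiskerLeft_ringIso_obj]
  simp [monodromy]

theorem eq_ringIso (a : InvObj C) {x : C} (hx : toSkeleton x = (a : Skeleton C)) {c : C}
    {f : c ⟶ c} (hf : x ◁ f = monodromy x c) : f = (ringIso a c).hom := by
  obtain e : x ≅ a.obj := Skeleton.isoOfEq (hx.trans a.toSkeleton_obj.symm)
  apply a.whiskerLeft_injective
  rw [whiskerLeft_ringIso_obj, ← cancel_epi (e.hom ▷ c), monodromy_naturality_left, ← hf,
    whisker_exchange]

theorem ringIso_one (c : C) : (ringIso (1 : InvObj C) c).hom = 𝟙 c :=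
  (eq_ringIso (1 : InvObj C) (x := 𝟙_ C) rfl (by simp [monodromy])).symm

theorem ringIso_mul (a b : InvObj C) (c : C) :
    (ringIso (a * b) c).hom = (ringIso b c).hom ≫ (ringIso a c).hom := by
  symm
  apply eq_ringIso (a * b) (x := a.obj ⊗ b.obj)
  · rw [Skeleton.toSkeleton_tensorObj, a.toSkeleton_obj, b.toSkeleton_obj]; rfl
  · rw [monodromy_tensor_left, ← whiskerLeft_ringIso_obj a c, ringIso_naturality]
    have h : (β_ b.obj c).hom ≫ (ringIso a c).hom ▷ b.obj ≫ (β_ c b.obj).hom =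
        b.obj ◁ (ringIso a c).hom ≫ b.obj ◁ (ringIso b c).hom := by
      rw [whiskerLeft_ringIso_obj]; simp [monodromy]
    have h' := congrArg (a.obj ◁ ·) h
    simp only [MonoidalCategory.whiskerLeft_comp] at h'
    simp [reassoc_of% h']

theorem transparent_iff_ringIso (a : InvObj C) {x : C} (hx : toSkeleton x = (a : Skeleton C))
    (c : C) : Transparent x c ↔ (ringIso a c).hom = 𝟙 c := by
  rw [Transparent, ← whiskerLeft_ringIso a hx c]
  refine ⟨fun h => (eq_ringIso a hx ?_).symm, fun h => by rw [h, whiskerLeft_id]⟩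
  rw [whiskerLeft_id, ← h, whiskerLeft_ringIso a hx c]

/-- The subgroup `c' ∩ Inv(C)` of (classes of) invertible objects that are transparent to `c`. -/
def transparentSubgroup (c : C) : Subgroup (InvObj C) where
  carrier := {a | ∀ x : C, toSkeleton x = (a : Skeleton C) → Transparent x c}
  one_mem' x hx := by rw [transparent_iff_ringIso 1 hx, ringIso_one]
  mul_mem' {a b} ha hb x hx := by
    rw [transparent_iff_ringIso (a * b) hx, ringIso_mul,
      (transparent_iff_ringIso a a.toSkeleton_obj c).1 (ha _ a.toSkeleton_obj),
      (transparent_iff_ringIso b b.toSkeleton_obj c).1 (hb _ b.toSkeleton_obj), Category.comp_id]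
  inv_mem' {a} ha x hx := by
    have h := ringIso_mul a⁻¹ a c
    rw [inv_mul_cancel, ringIso_one,
      (transparent_iff_ringIso a a.toSkeleton_obj c).1 (ha _ a.toSkeleton_obj),
      Category.id_comp] at h
    rw [transparent_iff_ringIso a⁻¹ hx, ← h]

end Ring

/-! ### The maps of the sequence -/

section Maps

variable {C : Type u} [Category.{v} C] [Abelian C] [Linear ℂ C] [MonoidalCategory C]
  [BraidedCategory C]

/-- The component at `c` of an element of `π₂` of the categorical group of braided
autoequivalences, i.e. of a monoidal natural automorphism of the identity functor. -/
def pi2App (t : Pi2 (BrAut C)) (c : C) : c ⟶ c := t.hom.iso.hom.app c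

/-- The ring operator of an invertible object, as a monoidal natural automorphism of the identity
functor. -/
noncomputable def ringNat (a : InvObj C) : 𝟙_ (BrAut C) ⟶ 𝟙_ (BrAut C) :=
  BrAut.Hom.mk (NatIso.ofComponents (F := 𝟭 C) (G := 𝟭 C) (ringIso a) (ringIso_naturality a))
    { unit := by
        exact (Category.id_comp _).trans (ringIso_unit a)
      tensor := fun c d => by
        exact (Category.id_comp _).trans ((ringIso_tensor a c d).trans (Category.comp_id _).symm) }

/-- The ring operator homomorphism `a ↦ σ^a` from `Inv(C)` to `π₂`. -/
noncomputable def ringOperator : InvObj C →* Pi2 (BrAut C) where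
  toFun a := BrAut.isoOfHom (ringNat a)
  map_one' := Iso.ext (BrAut.hom_ext ringIso_one)
  map_mul' a b := Iso.ext (BrAut.hom_ext (ringIso_mul a b))

/-- The ring operator is characterized by `β_{c,x} ∘ β_{x,c} = id_x ⊗ σ^x_c`. -/
theorem whiskerLeft_ringOperator (a : InvObj C) {x : C} (hx : toSkeleton x = (a : Skeleton C))
    (c : C) : x ◁ pi2App (ringOperator a) c = (β_ x c).hom ≫ (β_ c x).hom :=
  whiskerLeft_ringIso a hx c

variable (A : Mon C)

/-- Evaluation at the algebra `A` of a monoidal natural automorphism of the identity functor. It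
takes values in `Aut_C(A)`, the group of algebra automorphisms of `A`. -/
def evalAt : Pi2 (BrAut C) →* Aut A where
  toFun t := Mon.mkIso (t.hom.iso.app A.X)
    (by
      have h₁ : η[A.X] ≫ pi2App t A.X = pi2App t (𝟙_ C) ≫ η[A.X] :=
        t.hom.iso.hom.naturality η[A.X]
      have h₂ : 𝟙 (𝟙_ C) ≫ pi2App t (𝟙_ C) = 𝟙 (𝟙_ C) := t.hom.isMonoidal.unit
      rw [Category.id_comp] at h₂
      rw [h₂, Category.id_comp] at h₁
      exact h₁)
    (by
      have h₁ : μ[A.X] ≫ pi2App t A.X = pi2App t (A.X ⊗ A.X) ≫ μ[A.X] :=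
        t.hom.iso.hom.naturality μ[A.X]
      have h₂ : 𝟙 (A.X ⊗ A.X) ≫ pi2App t (A.X ⊗ A.X) =
          (pi2App t A.X ⊗ₘ pi2App t A.X) ≫ 𝟙 (A.X ⊗ A.X) := t.hom.isMonoidal.tensor A.X A.X
      rw [Category.id_comp, Category.comp_id] at h₂
      rw [h₂] at h₁
      exact h₁)
  map_one' := Iso.ext (Mon.Hom.ext rfl)
  map_mul' _ _ := Iso.ext (Mon.Hom.ext rfl)

/-- The map `σ_A : Inv(C) → Aut_C(A)`, `a ↦ σ^a_A`. -/
noncomputable def sigma : InvObj C →* Aut A := (evalAt A).comp ringOperator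

/-- The map `λ ↦ [id_C, λ]` from `Aut_C(A)` to the truncation of the categorical group of
braided autoequivalences over `A`. -/
def autToPi1 : Aut A →* Pi1 (BrAutOver A) where
  toFun l := toSkeleton (BrAutOver.ofAut l)
  map_one' := rfl
  map_mul' l m := by
    rw [← Skeleton.toSkeleton_tensorObj]
    refine (congr_toSkeleton_of_iso (BrAutOver.isoOfHom
      (F := (BrAutOver.ofAut l).comp (BrAutOver.ofAut m)) (G := BrAutOver.ofAut (l * m))
      (BrAutOver.Hom.mk (λ_ (𝟙_ (BrAut C))).hom ?_))).symm
    rw [BrAutOver.comp_lam, BrAutOver.ofAut_lam, BrAutOver.ofAut_lam, BrAutOver.ofAut_lam]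
    exact Category.id_comp _

end Maps

/-!
Given a monoidal automorphism `t` of the identity functor, surjectivity of `σ` asks for an
invertible object whose monodromy is `t`. For simple `c`, sum over the simple objects `i`, with the
weights of a Kirby colour, the partial traces of the monodromy of `c` with `i` twisted by `t⁻¹`.
Sliding a strand `y` over the resulting encircling shows that precomposition with the twisted
monodromy at `y` does not change this endomorphism of `c`, so either the endomorphism vanishes or
the monodromy of `c` is `t`. In the latter case `c ⊗ c*` is transparent, hence the unit object, and
`c` is invertible.

The endomorphism cannot vanish for every `c`: pairing these relations with the dimensions of the `c`
and using the symmetry of the S-matrix, nondegeneracy kills all contributions except that of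
`i = 1`, which is a nonzero multiple of the global dimension `D = ∑ dimLeft i * dimRight i`.

No pivotal structure is available, so `D ≠ 0` takes an argument. Each summand does not depend on
the chosen pairings, whereas the ratios `τ i = dimRight i / dimLeft i` do. On the multiplicity space
of `k` in `y ⊗ i` the square of the monodromy is the scalar `τ y * τ i / τ k`. Hence complex
conjugation changes the traces of the monodromy only by phases, the conjugates of the numbers
`dimRight i`, corrected by the phases of `τ i`, satisfy the same fusion relations as `dimRight`, and
comparison of the two gives `D = ∑ |dimRight i|² / |τ i| > 0`.

Exactness of the sequence needs nothing beyond the definitions, except at `Aut A`, where it is the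
surjectivity of `σ`.
-/

/-! ### Partial traces and mates -/

section Planar

variable {C : Type u} [Category.{v} C] [MonoidalCategory C]

/-- The right partial trace of a morphism `V ⊗ X ⟶ W ⊗ X`: the strand `X` is closed with the
coevaluation of the pairing `(X, X')` and the evaluation of the pairing `(X', X)`. The two pairings
are unrelated, so that no pivotal structure is involved. -/
def partialTrace {V W X : C} (X' : C) [ExactPairing X X'] [ExactPairing X' X]
    (φ : V ⊗ X ⟶ W ⊗ X) : V ⟶ W :=
  (ρ_ V).inv ≫ V ◁ η_ X X' ≫ (α_ V X X').inv ≫ φ ▷ X' ≫ (α_ W X X').hom ≫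
    W ◁ ε_ X' X ≫ (ρ_ W).hom

theorem comp_partialTrace {U V W X : C} (X' : C) [ExactPairing X X'] [ExactPairing X' X]
    (f : U ⟶ V) (φ : V ⊗ X ⟶ W ⊗ X) :
    partialTrace X' (f ▷ X ≫ φ) = f ≫ partialTrace X' φ := by
  calc
    _ = (ρ_ U).inv ≫ (U ◁ η_ X X' ≫ f ▷ _) ≫ (α_ V X X').inv ≫ φ ▷ X' ≫ (α_ W X X').hom ≫
        W ◁ ε_ X' X ≫ (ρ_ W).hom := by simp [partialTrace]
    _ = _ := by rw [whisker_exchange]; simp [partialTrace]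

theorem partialTrace_comp {V W Z X : C} (X' : C) [ExactPairing X X'] [ExactPairing X' X]
    (φ : V ⊗ X ⟶ W ⊗ X) (f : W ⟶ Z) :
    partialTrace X' (φ ≫ f ▷ X) = partialTrace X' φ ≫ f := by
  calc
    _ = (ρ_ V).inv ≫ V ◁ η_ X X' ≫ (α_ V X X').inv ≫ φ ▷ X' ≫ (α_ W X X').hom ≫
        (f ▷ _ ≫ _ ◁ ε_ X' X) ≫ (ρ_ Z).hom := by simp [partialTrace]
    _ = _ := by rw [← whisker_exchange]; simp [partialTrace]

theorem whiskerLeft_partialTrace {V W X : C} (Y X' : C) [ExactPairing X X'] [ExactPairing X' X]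
    (φ : V ⊗ X ⟶ W ⊗ X) :
    Y ◁ partialTrace X' φ =
      partialTrace X' ((α_ Y V X).hom ≫ Y ◁ φ ≫ (α_ Y W X).inv) := by
  simp only [partialTrace]; monoidal

variable {y i i' k k' : C}

section

variable [ExactPairing i i'] [ExactPairing k k']

/-- The morphism `k' ⊗ y ⟶ i'` obtained from `y ⊗ i ⟶ k` by bending both strands `i` and `k`. -/
def mateDown (i' k' : C) [ExactPairing i i'] [ExactPairing k k'] (f : y ⊗ i ⟶ k) : k' ⊗ y ⟶ i' :=
  (tensorLeftHomEquiv y k k' i').symm (tensorRightHomEquiv y i i' k f)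

theorem mateDown_coevaluation (f : y ⊗ i ⟶ k) :
    (λ_ y).inv ≫ η_ k k' ▷ y ≫ (α_ _ _ _).hom ≫ k ◁ mateDown i' k' f =
      (ρ_ y).inv ≫ y ◁ η_ i i' ≫ (α_ _ _ _).inv ≫ f ▷ i' :=
  (tensorLeftHomEquiv y k k' i').apply_symm_apply (tensorRightHomEquiv y i i' k f)

theorem mateDown_evaluation (f : y ⊗ i ⟶ k) :
    mateDown i' k' f ▷ i ≫ ε_ i i' = (α_ _ _ _).hom ≫ k' ◁ f ≫ ε_ k k' := by
  set bent := tensorRightHomEquiv y i i' k f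
  have unbend : bent ▷ i ≫ (α_ _ _ _).hom ≫ k ◁ ε_ i i' ≫ (ρ_ k).hom = f :=
    (tensorRightHomEquiv y i i' k).symm_apply_apply f
  have mate_eq :
      mateDown i' k' f = k' ◁ bent ≫ (α_ _ _ _).inv ≫ ε_ k k' ▷ i' ≫ (λ_ i').hom := rfl
  rw [mate_eq]
  calc
    _ = (α_ _ _ _).hom ≫ k' ◁ bent ▷ i ⊗≫ (ε_ k k' ▷ (i' ⊗ i) ≫ 𝟙_ C ◁ ε_ i i') ⊗≫ 𝟙 _ := by
      monoidal
    _ = (α_ _ _ _).hom ≫ k' ◁ (bent ▷ i ≫ (α_ _ _ _).hom ≫ k ◁ ε_ i i' ≫ (ρ_ k).hom) ≫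
        ε_ k k' := by
      rw [← whisker_exchange]; monoidal
    _ = _ := by rw [unbend]

end

section

variable [ExactPairing i' i] [ExactPairing k' k]

/-- The bijection between morphisms `k ⟶ y ⊗ i` and `i' ⟶ k' ⊗ y` obtained by bending both strands
`i` and `k`. -/
def mateUp (y i' k' : C) [ExactPairing i' i] [ExactPairing k' k] :
    (k ⟶ y ⊗ i) ≃ (i' ⟶ k' ⊗ y) :=
  (tensorRightHomEquiv k i' i y).symm.trans (tensorLeftHomEquiv i' k' k y)

theorem mateUp_evaluation (g : k ⟶ y ⊗ i) :
    k ◁ mateUp y i' k' g ≫ (α_ _ _ _).inv ≫ ε_ k' k ▷ y ≫ (λ_ y).hom =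
      g ▷ i' ≫ (α_ _ _ _).hom ≫ y ◁ ε_ i' i ≫ (ρ_ y).hom :=
  (tensorLeftHomEquiv i' k' k y).symm_apply_apply ((tensorRightHomEquiv k i' i y).symm g)

theorem mateUp_coevaluation (g : k ⟶ y ⊗ i) :
    η_ i' i ≫ mateUp y i' k' g ▷ i = η_ k' k ≫ k' ◁ g ≫ (α_ _ _ _).inv := by
  set bent := (tensorRightHomEquiv k i' i y).symm g
  have unbend : (ρ_ k).inv ≫ k ◁ η_ i' i ≫ (α_ _ _ _).inv ≫ bent ▷ i = g :=
    (tensorRightHomEquiv k i' i y).apply_symm_apply g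
  have mate_eq :
      mateUp y i' k' g = (λ_ i').inv ≫ η_ k' k ▷ i' ≫ (α_ _ _ _).hom ≫ k' ◁ bent := rfl
  rw [mate_eq]
  calc
    _ = (𝟙 _ ⊗≫ 𝟙_ C ◁ η_ i' i ≫ η_ k' k ▷ (i' ⊗ i)) ⊗≫ k' ◁ bent ▷ i ⊗≫ 𝟙 _ := by monoidal
    _ = η_ k' k ≫ k' ◁ ((ρ_ k).inv ≫ k ◁ η_ i' i ≫ (α_ _ _ _).inv ≫ bent ▷ i) ≫
        (α_ _ _ _).inv := by
      rw [whisker_exchange]; monoidal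
    _ = _ := by rw [unbend]

end

variable [ExactPairing i i'] [ExactPairing k k'] [ExactPairing i' i] [ExactPairing k' k]

theorem mateUp_comp_mateDown (f : y ⊗ i ⟶ k) (g : k ⟶ y ⊗ i) :
    η_ i' i ≫ (mateUp y i' k' g ≫ mateDown i' k' f) ▷ i ≫ ε_ i i' =
      η_ k' k ≫ k' ◁ (g ≫ f) ≫ ε_ k k' := by
  rw [comp_whiskerRight, Category.assoc, mateDown_evaluation, reassoc_of% mateUp_coevaluation g]
  simp

/-- The right partial trace over `k` of `φ`, with a strand `y` running alongside and an endomorphism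
of `k' ⊗ y` inserted. It interpolates between the two sides of the handle slide
`integral_tensorLeftTensor`. -/
def insertTrace {V W : C} (y k' : C) [ExactPairing k k'] [ExactPairing k' k]
    (φ : V ⊗ k ⟶ W ⊗ k) (θ : k' ⊗ y ⟶ k' ⊗ y) : V ⊗ y ⟶ W ⊗ y :=
  V ◁ ((λ_ y).inv ≫ η_ k k' ▷ y ≫ (α_ _ _ _).hom ≫ k ◁ θ) ≫ (α_ _ _ _).inv ≫
    φ ▷ (k' ⊗ y) ≫ (α_ _ _ _).hom ≫ W ◁ ((α_ _ _ _).inv ≫ ε_ k' k ▷ y ≫ (λ_ y).hom)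

theorem insertTrace_id {V W : C} (φ : V ⊗ k ⟶ W ⊗ k) :
    insertTrace y k' φ (𝟙 _) = partialTrace k' φ ▷ y := by
  simp only [insertTrace, partialTrace]; monoidal

theorem partialTrace_eq_insertTrace {V W : C} (φ : V ⊗ k ⟶ W ⊗ k) (f : y ⊗ i ⟶ k)
    (g : k ⟶ y ⊗ i) :
    partialTrace i' ((α_ _ _ _).hom ≫ (V ◁ f ≫ φ ≫ W ◁ g) ≫ (α_ _ _ _).inv) =
      insertTrace y k' φ (mateDown i' k' f ≫ mateUp y i' k' g) := by
  symm
  calc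
    _ = V ◁ ((λ_ y).inv ≫ η_ k k' ▷ y ≫ (α_ _ _ _).hom ≫ k ◁ mateDown i' k' f) ⊗≫
        ((V ⊗ k) ◁ mateUp y i' k' g ≫ φ ▷ (k' ⊗ y)) ⊗≫
          W ◁ ((α_ _ _ _).inv ≫ ε_ k' k ▷ y ≫ (λ_ y).hom) := by
      simp only [insertTrace]; monoidal
    _ = V ◁ ((ρ_ y).inv ≫ y ◁ η_ i i' ≫ (α_ _ _ _).inv ≫ f ▷ i') ⊗≫ φ ▷ i' ⊗≫
        W ◁ (k ◁ mateUp y i' k' g ≫ (α_ _ _ _).inv ≫ ε_ k' k ▷ y ≫ (λ_ y).hom) := by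
      rw [whisker_exchange, mateDown_coevaluation]; monoidal
    _ = V ◁ ((ρ_ y).inv ≫ y ◁ η_ i i' ≫ (α_ _ _ _).inv ≫ f ▷ i') ⊗≫ φ ▷ i' ⊗≫
        W ◁ (g ▷ i' ≫ (α_ _ _ _).hom ≫ y ◁ ε_ i' i ≫ (ρ_ y).hom) := by
      rw [mateUp_evaluation]
    _ = _ := by simp only [partialTrace]; monoidal

end Planar

section Linear

variable {C : Type u} [Category.{v} C] [Preadditive C] [MonoidalCategory C] [MonoidalPreadditive C]
  {V W X X' : C} [ExactPairing X X'] [ExactPairing X' X]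

theorem partialTrace_sum {J : Type*} (s : Finset J) (φ : J → (V ⊗ X ⟶ W ⊗ X)) :
    partialTrace X' (∑ j ∈ s, φ j) = ∑ j ∈ s, partialTrace X' (φ j) := by
  simp [partialTrace, sum_whiskerRight, Preadditive.comp_sum, Preadditive.sum_comp]

theorem insertTrace_sum {y : C} {J : Type*} (s : Finset J) (φ : V ⊗ X ⟶ W ⊗ X)
    (θ : J → (X' ⊗ y ⟶ X' ⊗ y)) :
    insertTrace y X' φ (∑ j ∈ s, θ j) = ∑ j ∈ s, insertTrace y X' φ (θ j) := by
  simp [insertTrace, whiskerLeft_sum, Preadditive.comp_sum, Preadditive.sum_comp]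

variable {R : Type*} [Semiring R] [Linear R C] [MonoidalLinear R C]

theorem partialTrace_smul (r : R) (φ : V ⊗ X ⟶ W ⊗ X) :
    partialTrace X' (r • φ) = r • partialTrace X' φ := by
  simp [partialTrace]

theorem insertTrace_smul {y : C} (r : R) (φ : V ⊗ X ⟶ W ⊗ X) (θ : X' ⊗ y ⟶ X' ⊗ y) :
    insertTrace y X' φ (r • θ) = r • insertTrace y X' φ θ := by
  simp [insertTrace]

theorem mateUp_sum_smul {y i i' k k' : C} [ExactPairing i' i] [ExactPairing k' k] {J : Type*}
    (s : Finset J) (r : J → R) (g : J → (k ⟶ y ⊗ i)) :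
    mateUp y i' k' (∑ j ∈ s, r j • g j) = ∑ j ∈ s, r j • mateUp y i' k' (g j) := by
  simp [mateUp, tensorLeftHomEquiv, tensorRightHomEquiv, whiskerLeft_sum, sum_whiskerRight,
    Preadditive.comp_sum, Preadditive.sum_comp]

end Linear

/-! ### Semisimplicity -/

section Irr

variable {C : Type u} [Category.{v} C]

section

variable [Limits.HasZeroMorphisms C]

variable (C) in
/-- The isomorphism classes of simple objects. -/
def Irr : Type u := {q : Skeleton C // Simple ((fromSkeleton C).obj q)}

/-- A representative of an isomorphism class of simple objects. -/
noncomputable def Irr.obj (k : Irr C) : C := (fromSkeleton C).obj k.1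

instance (k : Irr C) : Simple k.obj := k.2

theorem Irr.eq_of_iso {k l : Irr C} (e : k.obj ≅ l.obj) : k = l := by
  apply Subtype.ext
  rw [← toSkeleton_fromSkeleton_obj k.1, ← toSkeleton_fromSkeleton_obj l.1]
  exact congr_toSkeleton_of_iso e

theorem Irr.exists_iso (X : C) [Simple X] : ∃ k : Irr C, Nonempty (X ≅ k.obj) := by
  have e : X ≅ (fromSkeleton C).obj (toSkeleton X) :=
    Skeleton.isoOfEq (toSkeleton_fromSkeleton_obj _).symm
  exact ⟨⟨toSkeleton X, Simple.of_iso e.symm⟩, ⟨e⟩⟩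

end

variable [Preadditive C] [Limits.HasKernels C]

theorem Irr.hom_eq_zero {k l : Irr C} (h : k ≠ l) (f : k.obj ⟶ l.obj) : f = 0 := by
  by_contra hf
  have := isIso_of_hom_simple hf
  exact h (Irr.eq_of_iso (asIso f))

section Scalar

variable (𝕜 : Type*) [Field 𝕜] [IsAlgClosed 𝕜] [Linear 𝕜 C]

/-- The scalar by which an endomorphism of a simple object acts (Schur's lemma). -/
noncomputable def scalarOf (X : C) [Simple X] [FiniteDimensional 𝕜 (X ⟶ X)] : (X ⟶ X) ≃ₗ[𝕜] 𝕜 :=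
  (LinearEquiv.ofBijective (LinearMap.toSpanSingleton 𝕜 (X ⟶ X) (𝟙 X))
    ⟨smul_left_injective 𝕜 (id_nonzero X), endomorphism_simple_eq_smul_id 𝕜⟩).symm

variable {X : C} [Simple X] [FiniteDimensional 𝕜 (X ⟶ X)]

theorem scalarOf_smul_id (f : X ⟶ X) : scalarOf 𝕜 X f • 𝟙 X = f :=
  (scalarOf 𝕜 X).symm_apply_apply f

@[simp] theorem scalarOf_id : scalarOf 𝕜 X (𝟙 X) = 1 := by
  apply smul_left_injective 𝕜 (id_nonzero X)
  simp only [scalarOf_smul_id, one_smul]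

end Scalar

end Irr

section Decomp

variable {C : Type u} [Category.{v} C] [Preadditive C] [Fintype (Irr C)]

/-- A decomposition of an object into simple objects, in the form of dual bases of the multiplicity
spaces `k ⟶ X` and `X ⟶ k`. -/
structure Decomp (X : C) where
  idx : Irr C → Type
  [fintype : ∀ k, Fintype (idx k)]
  [decEq : ∀ k, DecidableEq (idx k)]
  proj : ∀ k, idx k → (X ⟶ k.obj)
  incl : ∀ k, idx k → (k.obj ⟶ X)
  incl_proj : ∀ k a b, incl k a ≫ proj k b = if a = b then 𝟙 _ else 0
  total : ∑ k, ∑ a, proj k a ≫ incl k a = 𝟙 X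

attribute [instance] Decomp.fintype Decomp.decEq

namespace Decomp

variable {X : C} (d : Decomp X)

include d in
theorem hom_ext {Y : C} {f g : X ⟶ Y} (h : ∀ (k : Irr C) (x : k.obj ⟶ X), x ≫ f = x ≫ g) :
    f = g := by
  rw [← Category.id_comp f, ← Category.id_comp g, ← d.total]
  simp [Preadditive.sum_comp, h]

include d in
theorem exists_irr_hom_ne_zero (hX : 𝟙 X ≠ 0) : ∃ (k : Irr C) (x : k.obj ⟶ X), x ≠ 0 := by
  by_contra! H
  exact hX (d.hom_ext fun k x => by simp [H k x])

variable [Limits.HasKernels C]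

theorem comp_proj_eq_zero {k l : Irr C} (h : k ≠ l) (f : k.obj ⟶ X) (b : d.idx l) :
    f ≫ d.proj l b = 0 := Irr.hom_eq_zero h _

include d in
theorem exists_retraction {s : C} [Simple s] {g : s ⟶ X} (hg : g ≠ 0) :
    ∃ f : X ⟶ s, g ≫ f = 𝟙 s := by
  obtain ⟨k, a, hka⟩ : ∃ k a, g ≫ d.proj k a ≠ 0 := by
    by_contra! H
    apply hg
    rw [← Category.comp_id g, ← d.total]
    simp [Preadditive.comp_sum, reassoc_of% H]
  have := isIso_of_hom_simple hka
  exact ⟨d.proj k a ≫ inv (g ≫ d.proj k a), by rw [← Category.assoc, IsIso.hom_inv_id]⟩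

variable {𝕜 : Type*} [Field 𝕜] [Linear 𝕜 C]

theorem hom_eq_sum [IsAlgClosed 𝕜] {k : Irr C} [FiniteDimensional 𝕜 (k.obj ⟶ k.obj)]
    (f : k.obj ⟶ X) :
    f = ∑ a, scalarOf 𝕜 k.obj (f ≫ d.proj k a) • d.incl k a :=
  calc
    f = ∑ l, ∑ a, (f ≫ d.proj l a) ≫ d.incl l a := by
      conv_lhs => rw [← Category.comp_id f, ← d.total]
      simp [Preadditive.comp_sum]
    _ = ∑ a, (f ≫ d.proj k a) ≫ d.incl k a := by
      refine Finset.sum_eq_single k (fun l _ hl => ?_) (by simp)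
      simp only [d.comp_proj_eq_zero hl.symm, Limits.zero_comp, Finset.sum_const_zero]
    _ = _ := by
      refine Finset.sum_congr rfl fun a _ => ?_
      conv_lhs => rw [← scalarOf_smul_id 𝕜 (f ≫ d.proj k a)]
      simp

include d in
theorem simple_of_end_eq_smul (hX : 𝟙 X ≠ 0) (h : ∀ φ : X ⟶ X, ∃ c : 𝕜, φ = c • 𝟙 X) :
    Simple X := by
  obtain ⟨k, x, hx⟩ := d.exists_irr_hom_ne_zero hX
  obtain ⟨f, hxf⟩ := d.exists_retraction hx
  obtain ⟨c, hc⟩ := h (f ≫ x)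
  have smul_x : c • x = (1 : 𝕜) • x :=
    calc c • x = x ≫ f ≫ x := by rw [hc]; simp
      _ = (1 : 𝕜) • x := by rw [reassoc_of% hxf, one_smul]
  have hfx : f ≫ x = 𝟙 X := by rw [hc, smul_left_injective 𝕜 hx smul_x, one_smul]
  exact Simple.of_iso (Y := k.obj) ⟨f, x, hfx, hxf⟩

end Decomp

end Decomp

section Duality

variable {C : Type u} [Category.{v} C] [Preadditive C] [MonoidalCategory C]
  {X X' : C} [ExactPairing X X']

theorem coevaluation_ne_zero [MonoidalPreadditive C] [Simple X] : η_ X X' ≠ 0 := by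
  intro h
  have zigzag := ExactPairing.evaluation_coevaluation X X'
  rw [h, MonoidalPreadditive.zero_whiskerRight, Limits.zero_comp] at zigzag
  apply id_nonzero X
  rw [← cancel_epi (λ_ X).hom, ← cancel_mono (ρ_ X).inv]
  simpa using zigzag.symm

variable (𝕜 : Type*) [Field 𝕜] [IsAlgClosed 𝕜] [Linear 𝕜 C] [MonoidalPreadditive C]
  [MonoidalLinear 𝕜 C] [Limits.HasKernels C]

theorem eq_smul_evaluation_of_simple_left [Simple X] [FiniteDimensional 𝕜 (X ⟶ X)]
    (f : X' ⊗ X ⟶ 𝟙_ C) : ∃ c : 𝕜, f = c • ε_ X X' := by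
  refine ⟨scalarOf 𝕜 X (tensorLeftHomEquiv X X X' (𝟙_ C) f ≫ (ρ_ X).hom), ?_⟩
  apply (tensorLeftHomEquiv X X X' (𝟙_ C)).injective
  rw [← cancel_mono (ρ_ X).hom]
  conv_lhs => rw [← scalarOf_smul_id 𝕜 (tensorLeftHomEquiv X X X' (𝟙_ C) f ≫ (ρ_ X).hom)]
  simp [tensorLeftHomEquiv]

theorem eq_smul_evaluation_of_simple_right [Simple X'] [FiniteDimensional 𝕜 (X' ⟶ X')]
    (f : X' ⊗ X ⟶ 𝟙_ C) : ∃ c : 𝕜, f = c • ε_ X X' := by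
  refine ⟨scalarOf 𝕜 X' (tensorRightHomEquiv X' X X' (𝟙_ C) f ≫ (λ_ X').hom), ?_⟩
  apply (tensorRightHomEquiv X' X X' (𝟙_ C)).injective
  rw [← cancel_mono (λ_ X').hom]
  conv_lhs => rw [← scalarOf_smul_id 𝕜 (tensorRightHomEquiv X' X X' (𝟙_ C) f ≫ (λ_ X').hom)]
  simp [tensorRightHomEquiv]

theorem eq_smul_coevaluation_of_simple [Simple X] [FiniteDimensional 𝕜 (X ⟶ X)]
    (f : 𝟙_ C ⟶ X ⊗ X') : ∃ c : 𝕜, f = c • η_ X X' := by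
  refine ⟨scalarOf 𝕜 X ((λ_ X).inv ≫ (tensorRightHomEquiv (𝟙_ C) X X' X).symm f), ?_⟩
  apply (tensorRightHomEquiv (𝟙_ C) X X' X).symm.injective
  rw [← cancel_epi (λ_ X).inv]
  conv_lhs => rw [← scalarOf_smul_id 𝕜 ((λ_ X).inv ≫ (tensorRightHomEquiv (𝟙_ C) X X' X).symm f)]
  simp [tensorRightHomEquiv, unitors_equal]

theorem end_dual_eq_smul [Simple X] [FiniteDimensional 𝕜 (X ⟶ X)] (φ : X' ⟶ X') :
    ∃ c : 𝕜, φ = c • 𝟙 X' := by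
  obtain ⟨c, hc⟩ := eq_smul_evaluation_of_simple_left 𝕜
    ((tensorRightHomEquiv X' X X' (𝟙_ C)).symm (φ ≫ (λ_ X').inv))
  refine ⟨c, ?_⟩
  rw [Equiv.symm_apply_eq] at hc
  rw [← cancel_mono (λ_ X').inv, hc]
  simp [tensorRightHomEquiv]

end Duality

section Semisimple

attribute [local instance] Abelian.hasFiniteBiproducts

variable {C : Type u} [Category.{v} C] [Abelian C] [Linear ℂ C] [MonoidalCategory C]
  [MonoidalPreadditive C] [MonoidalLinear ℂ C] [RigidCategory C] [IsFusionCategory C]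

instance (X Y : C) : FiniteDimensional ℂ (X ⟶ Y) :=
  IsFusionCategory.finiteDimensional_hom X Y

instance : Simple (𝟙_ C) := IsFusionCategory.simple_unit

instance : Finite (Irr C) := by
  obtain ⟨n, S, hS⟩ := IsFusionCategory.finite_simples (C := C)
  choose i hi using fun k : Irr C => hS k.obj inferInstance
  exact Finite.of_injective i fun k l h =>
    Irr.eq_of_iso ((hi k).some ≪≫ eqToIso (congrArg S h) ≪≫ (hi l).some.symm)

noncomputable instance : Fintype (Irr C) := Fintype.ofFinite _

theorem exists_decomp (X : C) : Nonempty (Decomp X) := by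
  classical
  obtain ⟨n, S, hS, ⟨e⟩⟩ := IsFusionCategory.semisimple X
  choose κ hκ using fun a => have := hS a; Irr.exists_iso (S a)
  let θ (a : Fin n) : S a ≅ (κ a).obj := (hκ a).some
  have obj_eq (k : Irr C) (a : {a // κ a = k}) : (κ a.1).obj = k.obj := by rw [a.2]
  let proj (k : Irr C) (a : {a // κ a = k}) : X ⟶ k.obj :=
    e.hom ≫ Limits.biproduct.π S a.1 ≫ (θ a.1).hom ≫ eqToHom (obj_eq k a)
  let incl (k : Irr C) (a : {a // κ a = k}) : k.obj ⟶ X :=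
    eqToHom (obj_eq k a).symm ≫ (θ a.1).inv ≫ Limits.biproduct.ι S a.1 ≫ e.inv
  have proj_incl (k : Irr C) (a : {a // κ a = k}) : proj k a ≫ incl k a =
      e.hom ≫ (Limits.biproduct.π S a.1 ≫ Limits.biproduct.ι S a.1) ≫ e.inv := by
    simp [proj, incl]
  refine ⟨{ idx := fun k => {a // κ a = k}, proj, incl, incl_proj := ?_, total := ?_ }⟩
  · rintro k ⟨a, rfl⟩ ⟨b, hb⟩
    by_cases hab : a = b
    · subst hab; simp [proj, incl]
    · simp [proj, incl, hab, Limits.biproduct.ι_π_ne_assoc S hab]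
  · calc
      _ = ∑ k, ∑ a : {a // κ a = k},
          e.hom ≫ (Limits.biproduct.π S a.1 ≫ Limits.biproduct.ι S a.1) ≫ e.inv :=
        Finset.sum_congr rfl fun k _ => Finset.sum_congr rfl fun a _ => proj_incl k a
      _ = ∑ a, e.hom ≫ (Limits.biproduct.π S a ≫ Limits.biproduct.ι S a) ≫ e.inv :=
        Fintype.sum_fiberwise κ fun a =>
          e.hom ≫ (Limits.biproduct.π S a ≫ Limits.biproduct.ι S a) ≫ e.inv
      _ = 𝟙 X := by
        rw [← Preadditive.comp_sum, ← Preadditive.sum_comp, Limits.biproduct.total]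
        simp

/-- A chosen decomposition of an object into simple objects. -/
noncomputable def decomp (X : C) : Decomp X := (exists_decomp X).some

theorem coevaluation_comp_evaluation_ne_zero {X X' : C} [ExactPairing X X'] [ExactPairing X' X]
    [Simple X] : η_ X X' ≫ ε_ X' X ≠ 0 := by
  intro h
  obtain ⟨f, hf⟩ := (decomp _).exists_retraction (coevaluation_ne_zero (X := X) (X' := X'))
  obtain ⟨c, rfl⟩ := eq_smul_evaluation_of_simple_right ℂ f
  rw [Linear.comp_smul, h, smul_zero] at hf
  exact id_nonzero (𝟙_ C) hf.symm

theorem simple_of_exactPairing (X X' : C) [ExactPairing X X'] [Simple X] : Simple X' := by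
  refine (decomp X').simple_of_end_eq_smul (𝕜 := ℂ) (fun h => ?_) (end_dual_eq_smul (X := X) ℂ)
  apply coevaluation_ne_zero (X := X) (X' := X')
  rw [← Category.comp_id (η_ X X'), ← whiskerLeft_id, h, MonoidalPreadditive.whiskerLeft_zero,
    Limits.comp_zero]

instance (X : C) [Simple X] : Simple Xᘁ := simple_of_exactPairing X Xᘁ

theorem dual_hom_eq_zero {i j : Irr C} (h : i ≠ j) (f : i.objᘁ ⟶ j.objᘁ) : f = 0 := by
  by_contra hf
  have := isIso_of_hom_simple hf
  exact h (Irr.eq_of_iso (leftDualIso inferInstance (exactPairingCongrRight (asIso f))))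

end Semisimple

/-! ### Integration over the simple objects -/

section Integral

variable {C : Type u} [Category.{v} C] [Abelian C] [Linear ℂ C] [MonoidalCategory C]
  [MonoidalPreadditive C] [MonoidalLinear ℂ C] [RigidCategory C] [IsFusionCategory C]
  [∀ X : C, ExactPairing Xᘁ X]

/-- The right dimension of an object, with respect to the given pairings `(X, Xᘁ)` and `(Xᘁ, X)`.
In the absence of a pivotal structure only products such as `dimRight X * dimLeft X` are independent
of the choice of the pairings. -/
noncomputable def dimRight (X : C) : ℂ := scalarOf ℂ (𝟙_ C) (η_ X Xᘁ ≫ ε_ Xᘁ X)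

/-- The left dimension of an object, with respect to the given pairings `(X, Xᘁ)` and `(Xᘁ, X)`. -/
noncomputable def dimLeft (X : C) : ℂ := scalarOf ℂ (𝟙_ C) (η_ Xᘁ X ≫ ε_ X Xᘁ)

theorem dimRight_ne_zero (X : C) [Simple X] : dimRight X ≠ 0 :=
  (scalarOf ℂ (𝟙_ C)).map_eq_zero_iff.not.2 coevaluation_comp_evaluation_ne_zero

theorem dimLeft_ne_zero (X : C) [Simple X] : dimLeft X ≠ 0 :=
  (scalarOf ℂ (𝟙_ C)).map_eq_zero_iff.not.2 coevaluation_comp_evaluation_ne_zero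

theorem partialTrace_id (V X : C) : partialTrace Xᘁ (𝟙 (V ⊗ X)) = dimRight X • 𝟙 V := by
  have h : partialTrace Xᘁ (𝟙 (V ⊗ X)) =
      (ρ_ V).inv ≫ V ◁ (η_ X Xᘁ ≫ ε_ Xᘁ X) ≫ (ρ_ V).hom := by
    simp [partialTrace]
  rw [h, ← scalarOf_smul_id ℂ (η_ X Xᘁ ≫ ε_ Xᘁ X)]
  simp [dimRight]

theorem scalarOf_mateUp_comp_mateDown {y i k : C} [Simple i] [Simple k] (f : y ⊗ i ⟶ k)
    (g : k ⟶ y ⊗ i) :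
    scalarOf ℂ iᘁ (mateUp y iᘁ kᘁ g ≫ mateDown iᘁ kᘁ f) * dimLeft i =
      scalarOf ℂ k (g ≫ f) * dimLeft k := by
  have h := mateUp_comp_mateDown (i' := iᘁ) (k' := kᘁ) f g
  rw [← scalarOf_smul_id ℂ (mateUp y iᘁ kᘁ g ≫ mateDown iᘁ kᘁ f),
    ← scalarOf_smul_id ℂ (g ≫ f)] at h
  simpa [dimLeft] using congrArg (scalarOf ℂ (𝟙_ C)) h

theorem exists_dual_iso (k : Irr C) : ∃ i : Irr C, Nonempty (i.objᘁ ≅ k.obj) := by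
  obtain ⟨i, ⟨e⟩⟩ := Irr.exists_iso k.objᘁ
  let : ExactPairing i.obj k.obj := exactPairingCongrLeft e.symm
  exact ⟨i, ⟨rightDualIso inferInstance this⟩⟩

/-- The rescaled mates of dual bases of the multiplicity spaces of `y ⊗ i` are dual bases of the
multiplicity spaces of `kᘁ ⊗ y`. -/
theorem sum_mateDown_comp_mateUp (y : C) (k : Irr C) :
    ∑ i : Irr C, ∑ a, dimLeft i.obj • (mateDown i.objᘁ k.objᘁ ((decomp (y ⊗ i.obj)).proj k a) ≫
      mateUp y i.objᘁ k.objᘁ ((decomp (y ⊗ i.obj)).incl k a)) =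
        dimLeft k.obj • 𝟙 (k.objᘁ ⊗ y) := by
  refine (decomp _).hom_ext fun l x => ?_
  obtain ⟨i, ⟨e⟩⟩ := exists_dual_iso l
  rw [← cancel_epi e.hom, ← Category.assoc, ← Category.assoc]
  obtain ⟨g, hg⟩ := (mateUp (i := i.obj) (k := k.obj) y i.objᘁ k.objᘁ).surjective (e.hom ≫ x)
  rw [← hg, Preadditive.comp_sum, Finset.sum_eq_single i]
  · conv_rhs => rw [(decomp (y ⊗ i.obj)).hom_eq_sum (𝕜 := ℂ) g, mateUp_sum_smul]
    rw [Preadditive.comp_sum, Linear.comp_smul, Category.comp_id, Finset.smul_sum]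
    refine Finset.sum_congr rfl fun a _ => ?_
    rw [Linear.comp_smul, ← Category.assoc, ← scalarOf_smul_id ℂ (mateUp y i.objᘁ k.objᘁ g ≫ _),
      Linear.smul_comp, Category.id_comp, smul_smul, smul_smul, mul_comm,
      scalarOf_mateUp_comp_mateDown, mul_comm]
  · intro j _ hj
    rw [Preadditive.comp_sum]
    refine Finset.sum_eq_zero fun a _ => ?_
    rw [Linear.comp_smul, ← Category.assoc,
      dual_hom_eq_zero hj.symm (mateUp y i.objᘁ k.objᘁ g ≫ _), Limits.zero_comp, smul_zero]
  · simp

/-- The sum, weighted by the left dimensions, of the partial traces over the simple objects of a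
natural family `V ⊗ X ⟶ W ⊗ X`: a partial trace over the Kirby colour. -/
noncomputable def integral {V W : C} (φ : tensorLeft V ⟶ tensorLeft W) : V ⟶ W :=
  ∑ i : Irr C, dimLeft i.obj • partialTrace i.objᘁ (φ.app i.obj)

/-- Handle slide: a strand `y` parallel to the Kirby colour can be pulled off it. -/
theorem integral_tensorLeftTensor {V W : C} (φ : tensorLeft V ⟶ tensorLeft W) (y : C) :
    integral ((tensorLeftTensor V y).hom ≫ Functor.whiskerLeft (tensorLeft y) φ ≫
      (tensorLeftTensor W y).inv) = integral φ ▷ y := by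
  have app_tensor (i : Irr C) : φ.app (y ⊗ i.obj) =
      ∑ k, ∑ a, V ◁ (decomp (y ⊗ i.obj)).proj k a ≫ φ.app k.obj ≫
        W ◁ (decomp (y ⊗ i.obj)).incl k a := by
    have naturality {X Y : C} (f : X ⟶ Y) : V ◁ f ≫ φ.app Y = φ.app X ≫ W ◁ f := φ.naturality f
    calc
      φ.app (y ⊗ i.obj) = V ◁ 𝟙 (y ⊗ i.obj) ≫ φ.app (y ⊗ i.obj) := by simp
      _ = _ := by
        rw [← (decomp (y ⊗ i.obj)).total]
        simp [whiskerLeft_sum, Preadditive.sum_comp, naturality]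
  have slide (i : Irr C) : dimLeft i.obj • partialTrace i.objᘁ
      ((α_ V y i.obj).hom ≫ φ.app (y ⊗ i.obj) ≫ (α_ W y i.obj).inv) =
      ∑ k : Irr C, insertTrace y k.objᘁ (φ.app k.obj)
        (∑ a, dimLeft i.obj • (mateDown i.objᘁ k.objᘁ ((decomp (y ⊗ i.obj)).proj k a) ≫
          mateUp y i.objᘁ k.objᘁ ((decomp (y ⊗ i.obj)).incl k a))) := by
    simp only [app_tensor, Preadditive.sum_comp, Preadditive.comp_sum, partialTrace_sum,
      Finset.smul_sum, insertTrace_sum, insertTrace_smul]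
    exact Finset.sum_congr rfl fun k _ => Finset.sum_congr rfl fun a _ => by
      rw [partialTrace_eq_insertTrace (k' := k.objᘁ)]
  calc
    _ = ∑ i : Irr C, dimLeft i.obj • partialTrace i.objᘁ
        ((α_ V y i.obj).hom ≫ φ.app (y ⊗ i.obj) ≫ (α_ W y i.obj).inv) := rfl
    _ = ∑ k : Irr C, insertTrace y k.objᘁ (φ.app k.obj) (dimLeft k.obj • 𝟙 (k.objᘁ ⊗ y)) := by
      simp only [slide, ← sum_mateDown_comp_mateUp, insertTrace_sum]
      exact Finset.sum_comm
    _ = integral φ ▷ y := by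
      simp only [integral, insertTrace_smul, insertTrace_id, sum_whiskerRight,
        MonoidalLinear.smul_whiskerRight]

end Integral

/-! ### Isotypic projections -/

section Isotypic

variable {C : Type u} [Category.{v} C] [Abelian C] [Linear ℂ C] [MonoidalCategory C]
  [MonoidalPreadditive C] [MonoidalLinear ℂ C] [RigidCategory C] [IsFusionCategory C]

theorem irr_comp_sum_proj_comp_incl {k l : Irr C} {X : C} (x : l.obj ⟶ X) :
    x ≫ ∑ a, (decomp X).proj k a ≫ (decomp X).incl k a =
      open Classical in if l = k then x else 0 := by
  rw [Preadditive.comp_sum]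
  split_ifs with h
  · subst h
    conv_rhs => rw [(decomp X).hom_eq_sum (𝕜 := ℂ) x]
    refine Finset.sum_congr rfl fun a _ => ?_
    conv_lhs => rw [← Category.assoc, ← scalarOf_smul_id ℂ (x ≫ (decomp X).proj l a)]
    rw [Linear.smul_comp, Category.id_comp]
  · refine Finset.sum_eq_zero fun a _ => ?_
    rw [← Category.assoc, (decomp X).comp_proj_eq_zero h, Limits.zero_comp]

/-- The natural transformation projecting each object onto its isotypic component of type `k`. -/
noncomputable def isotypicProj (k : Irr C) : 𝟭 C ⟶ 𝟭 C where
  app X := ∑ a, (decomp X).proj k a ≫ (decomp X).incl k a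
  naturality X Y f := by
    refine (decomp X).hom_ext fun l x => ?_
    have h := irr_comp_sum_proj_comp_incl (k := k) (x ≫ f)
    simp only [Category.assoc] at h
    simp only [Functor.id_obj, Functor.id_map, h, ← Category.assoc x (Finset.sum _ _),
      irr_comp_sum_proj_comp_incl, ite_comp, Limits.zero_comp]

theorem comp_isotypicProj {k : Irr C} {X : C} (x : k.obj ⟶ X) :
    x ≫ (isotypicProj k).app X = x :=
  (irr_comp_sum_proj_comp_incl x).trans (if_pos rfl)

theorem comp_isotypicProj_of_ne {k l : Irr C} (h : l ≠ k) {X : C} (x : l.obj ⟶ X) :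
    x ≫ (isotypicProj k).app X = 0 :=
  (irr_comp_sum_proj_comp_incl x).trans (if_neg h)

theorem isotypicProj_app_obj (k : Irr C) : (isotypicProj k).app k.obj = 𝟙 k.obj :=
  (Category.id_comp _).symm.trans (comp_isotypicProj (𝟙 k.obj))

theorem isotypicProj_app_obj_of_ne {k l : Irr C} (h : l ≠ k) : (isotypicProj k).app l.obj = 0 :=
  (Category.id_comp _).symm.trans (comp_isotypicProj_of_ne h (𝟙 l.obj))

variable [∀ X : C, ExactPairing Xᘁ X]

theorem integral_isotypicProj (k : Irr C) (V : C) :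
    integral (Functor.whiskerRight (isotypicProj k) (tensorLeft V)) =
      (dimLeft k.obj * dimRight k.obj) • 𝟙 V := by
  have app_self : (Functor.whiskerRight (isotypicProj k) (tensorLeft V)).app k.obj =
      𝟙 (V ⊗ k.obj) :=
    (congrArg (V ◁ ·) (isotypicProj_app_obj k)).trans (whiskerLeft_id V k.obj)
  have app_of_ne (l : Irr C) (hl : l ≠ k) :
      (Functor.whiskerRight (isotypicProj k) (tensorLeft V)).app l.obj = 0 :=
    (congrArg (V ◁ ·) (isotypicProj_app_obj_of_ne hl)).trans
      (MonoidalPreadditive.whiskerLeft_zero ..)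
  rw [integral, Finset.sum_eq_single k]
  · rw [app_self, ← smul_smul]
    exact congrArg (dimLeft k.obj • ·) (partialTrace_id V k.obj)
  · intro l _ hl
    rw [app_of_ne l hl]
    simp [partialTrace]
  · simp

theorem sum_partialTrace_isotypicProj (k : Irr C) (y : C) :
    ∑ i : Irr C, dimLeft i.obj • partialTrace i.objᘁ ((isotypicProj k).app (y ⊗ i.obj)) =
      (dimLeft k.obj * dimRight k.obj) • 𝟙 y := by
  let φ : tensorLeft (𝟙_ C) ⟶ tensorLeft (𝟙_ C) :=
    Functor.whiskerRight (isotypicProj k) (tensorLeft (𝟙_ C))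
  have remove_unit (i : C) : partialTrace iᘁ ((α_ (𝟙_ C) y i).hom ≫ φ.app (y ⊗ i) ≫
      (α_ (𝟙_ C) y i).inv) = (λ_ y).hom ≫ partialTrace iᘁ ((isotypicProj k).app (y ⊗ i)) ≫
        (λ_ y).inv := by
    rw [← partialTrace_comp, ← comp_partialTrace]
    congr 1
    simp only [φ, Functor.whiskerRight_app, curriedTensor_obj_map]
    monoidal
  have slide : ∑ i : Irr C, dimLeft i.obj • partialTrace i.objᘁ
      ((α_ (𝟙_ C) y i.obj).hom ≫ φ.app (y ⊗ i.obj) ≫ (α_ (𝟙_ C) y i.obj).inv) =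
        integral φ ▷ y := integral_tensorLeftTensor φ y
  rw [show integral φ = _ from integral_isotypicProj k (𝟙_ C)] at slide
  simp only [remove_unit] at slide
  rw [← cancel_epi (λ_ y).hom, ← cancel_mono (λ_ y).inv]
  simp only [Preadditive.comp_sum, Preadditive.sum_comp, Linear.comp_smul, Linear.smul_comp,
    Category.assoc, slide]
  simp

end Isotypic

/-! ### Traces in braided categories -/

section BraidedTrace

variable {C : Type u} [Category.{v} C] [MonoidalCategory C] [BraidedCategory C]

/-- The trace of an endomorphism, closing its strand with the braiding. -/
def braidedTrace {X : C} (X' : C) [ExactPairing X X'] (f : X ⟶ X) : 𝟙_ C ⟶ 𝟙_ C :=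
  η_ X X' ≫ f ▷ X' ≫ (β_ X X').hom ≫ ε_ X X'

theorem braidedTrace_comm {X Y X' Y' : C} [ExactPairing X X'] [ExactPairing Y Y']
    (f : X ⟶ Y) (g : Y ⟶ X) : braidedTrace X' (f ≫ g) = braidedTrace Y' (g ≫ f) := by
  let : HasRightDual X := ⟨X'⟩
  let : HasRightDual Y := ⟨Y'⟩
  obtain ⟨g', h₁, h₂⟩ : ∃ g' : X' ⟶ Y', η_ X X' ≫ X ◁ g' = η_ Y Y' ≫ g ▷ Y' ∧
      g' ▷ Y ≫ ε_ Y Y' = X' ◁ g ≫ ε_ X X' :=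
    ⟨gᘁ, coevaluation_comp_rightAdjointMate g, rightAdjointMate_comp_evaluation g⟩
  calc
    _ = η_ X X' ≫ f ▷ X' ≫ (g ▷ X' ≫ (β_ X X').hom) ≫ ε_ X X' := by simp [braidedTrace]
    _ = η_ X X' ≫ f ▷ X' ≫ ((β_ Y X').hom ≫ g' ▷ Y) ≫ ε_ Y Y' := by
      rw [BraidedCategory.braiding_naturality_left]; simp [h₂]
    _ = (η_ X X' ≫ X ◁ g') ≫ f ▷ Y' ≫ (β_ Y Y').hom ≫ ε_ Y Y' := by
      rw [← BraidedCategory.braiding_naturality_right]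
      simp [← whisker_exchange_assoc]
    _ = _ := by rw [h₁]; simp [braidedTrace]

theorem braiding_comp_cap {X Y Z : C} (p : X ⊗ Z ⟶ 𝟙_ C) :
    (β_ Y X).hom ▷ Z ≫ (α_ _ _ _).hom ≫ X ◁ (β_ Y Z).hom ≫ (α_ _ _ _).inv ≫ p ▷ Y =
      (α_ _ _ _).hom ≫ Y ◁ p ≫ (ρ_ Y).hom ≫ (λ_ Y).inv := by
  have h := BraidedCategory.braiding_naturality_right Y p
  rw [BraidedCategory.braiding_tensor_right_hom, braiding_tensorUnit_right] at h
  rw [h]; simp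

theorem monodromy_comp_cap (X Y X' Y' : C) [ExactPairing X X'] [ExactPairing Y Y'] :
    monodromy X Y ▷ (Y' ⊗ X') ≫ (β_ (X ⊗ Y) (Y' ⊗ X')).hom ≫ ε_ (X ⊗ Y) (Y' ⊗ X') =
      𝟙 _ ⊗≫ X ◁ ((β_ Y Y').hom ≫ ε_ Y Y') ▷ X' ⊗≫ (β_ X X').hom ≫ ε_ X X' := by
  have hε : ε_ (X ⊗ Y) (Y' ⊗ X') = 𝟙 _ ⊗≫ Y' ◁ (ε_ X X' ▷ Y) ⊗≫ ε_ Y Y' := rfl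
  have hX := braiding_comp_cap (Y := Y) ((β_ X X').hom ≫ ε_ X X')
  have hY := braiding_comp_cap (Y := X) ((β_ Y Y').hom ≫ ε_ Y Y')
  calc
    _ = (β_ X Y).hom ▷ (Y' ⊗ X') ⊗≫ ((β_ Y X).hom ▷ Y' ≫ (β_ (X ⊗ Y) Y').hom) ▷ X' ⊗≫
        Y' ◁ (X ◁ (β_ Y X').hom ≫ (α_ _ _ _).inv ≫ ((β_ X X').hom ≫ ε_ X X') ▷ Y) ⊗≫
          ε_ Y Y' := by
      rw [hε, monodromy, BraidedCategory.braiding_tensor_right_hom (X ⊗ Y),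
        BraidedCategory.braiding_tensor_left_hom X Y X']
      monoidal
    _ = (β_ X Y).hom ▷ (Y' ⊗ X') ⊗≫ (β_ (Y ⊗ X) Y').hom ▷ X' ⊗≫
        Y' ◁ ((β_ Y X).hom ▷ X' ≫ (α_ _ _ _).hom ≫
          X ◁ (β_ Y X').hom ≫ (α_ _ _ _).inv ≫ ((β_ X X').hom ≫ ε_ X X') ▷ Y) ⊗≫ ε_ Y Y' := by
      rw [BraidedCategory.braiding_naturality_left]; monoidal
    _ = (β_ X Y).hom ▷ (Y' ⊗ X') ⊗≫ Y ◁ (β_ X Y').hom ▷ X' ⊗≫ (β_ Y Y').hom ▷ (X ⊗ X') ⊗≫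
        ((Y' ⊗ Y) ◁ ((β_ X X').hom ≫ ε_ X X') ≫ ε_ Y Y' ▷ 𝟙_ C) ⊗≫ 𝟙 _ := by
      rw [hX, BraidedCategory.braiding_tensor_left_hom]; monoidal
    _ = 𝟙 _ ⊗≫ ((β_ X Y).hom ▷ Y' ≫ (α_ _ _ _).hom ≫ Y ◁ (β_ X Y').hom ≫ (α_ _ _ _).inv ≫
          ((β_ Y Y').hom ≫ ε_ Y Y') ▷ X) ▷ X' ⊗≫ ((β_ X X').hom ≫ ε_ X X') := by
      rw [whisker_exchange]; monoidal
    _ = _ := by rw [hY]; monoidal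

theorem braidedTrace_comp_monodromy {X Y X' Y' : C} [ExactPairing X X'] [ExactPairing Y Y']
    (f : X ⊗ Y ⟶ X ⊗ Y) :
    letI := BraidedCategory.exactPairing_swap Y Y'
    braidedTrace (Y' ⊗ X') (f ≫ monodromy X Y) = braidedTrace X' (partialTrace Y' f) := by
  have hη : η_ (X ⊗ Y) (Y' ⊗ X') = η_ X X' ⊗≫ (X ◁ η_ Y Y') ▷ X' ⊗≫ 𝟙 _ := rfl
  let := BraidedCategory.exactPairing_swap Y Y'
  have hε : ε_ Y' Y = (β_ Y Y').hom ≫ ε_ Y Y' := rfl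
  simp only [braidedTrace, partialTrace, comp_whiskerRight, Category.assoc, monodromy_comp_cap,
    hη, hε]
  monoidal

theorem trace_partialTrace_monodromy_comm (X Y X' Y' : C) [ExactPairing X X'] [ExactPairing Y Y'] :
    letI := BraidedCategory.exactPairing_swap X X'
    letI := BraidedCategory.exactPairing_swap Y Y'
    braidedTrace X' (partialTrace Y' (monodromy X Y)) =
      braidedTrace Y' (partialTrace X' (monodromy Y X)) := by
  rw [← braidedTrace_comp_monodromy, ← braidedTrace_comp_monodromy]
  have cycle : monodromy X Y ≫ monodromy X Y =
      (β_ X Y).hom ≫ (β_ Y X).hom ≫ (β_ X Y).hom ≫ (β_ Y X).hom := by simp [monodromy]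
  have cycle' : monodromy Y X ≫ monodromy Y X =
      ((β_ Y X).hom ≫ (β_ X Y).hom ≫ (β_ Y X).hom) ≫ (β_ X Y).hom := by simp [monodromy]
  rw [cycle, cycle', braidedTrace_comm (X' := Y' ⊗ X') (Y' := X' ⊗ Y')]

/-- The pairing `(X', X)` obtained from the pairing `(X, X')` and the inverse braiding. -/
abbrev reverseSwapPairing (X X' : C) [ExactPairing X X'] : ExactPairing X' X :=
  letI := reverseBraiding C
  BraidedCategory.exactPairing_swap X X'

/-- The trace of an endomorphism, closing its strand with the inverse braiding. -/
def reverseTrace {X : C} (X' : C) [ExactPairing X X'] (f : X ⟶ X) : 𝟙_ C ⟶ 𝟙_ C :=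
  η_ X X' ≫ f ▷ X' ≫ (β_ X' X).inv ≫ ε_ X X'

/-- The partial trace over `X`, closing its strand with the inverse braiding. -/
def reversePartialTrace {V W X : C} (X' : C) [ExactPairing X X'] (φ : V ⊗ X ⟶ W ⊗ X) : V ⟶ W :=
  letI := reverseSwapPairing X X'
  partialTrace X' φ

theorem reverseTrace_comm {X Y X' Y' : C} [ExactPairing X X'] [ExactPairing Y Y']
    (f : X ⟶ Y) (g : Y ⟶ X) : reverseTrace X' (f ≫ g) = reverseTrace Y' (g ≫ f) :=
  letI := reverseBraiding C
  braidedTrace_comm f g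

theorem reverseTrace_comp_inv_monodromy {X Y X' Y' : C} [ExactPairing X X'] [ExactPairing Y Y']
    (f : X ⊗ Y ⟶ X ⊗ Y) :
    reverseTrace (Y' ⊗ X') (f ≫ inv (monodromy X Y)) =
      reverseTrace X' (reversePartialTrace Y' f) := by
  have inv_eq : inv (monodromy X Y) = (β_ Y X).inv ≫ (β_ X Y).inv := by simp [monodromy]
  rw [inv_eq]
  exact @braidedTrace_comp_monodromy C _ _ (reverseBraiding C) X Y X' Y' _ _ f

section Linear

variable [Preadditive C] [MonoidalPreadditive C] {X X' : C} [ExactPairing X X']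

theorem braidedTrace_sum {J : Type*} (s : Finset J) (f : J → (X ⟶ X)) :
    braidedTrace X' (∑ j ∈ s, f j) = ∑ j ∈ s, braidedTrace X' (f j) := by
  simp [braidedTrace, sum_whiskerRight, Preadditive.comp_sum, Preadditive.sum_comp]

variable {R : Type*} [Semiring R] [Linear R C] [MonoidalLinear R C]

theorem braidedTrace_smul (r : R) (f : X ⟶ X) :
    braidedTrace X' (r • f) = r • braidedTrace X' f := by
  simp [braidedTrace]

theorem reverseTrace_smul (r : R) (f : X ⟶ X) :
    reverseTrace X' (r • f) = r • reverseTrace X' f := by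
  simp [reverseTrace]

end Linear

end BraidedTrace

/-! ### The global dimension -/

section Matrix

variable {J K : Type*} [Fintype J]

theorem exists_trace_eq_natCast [Field K] {P : Matrix J J K} (hP : IsIdempotentElem P) :
    ∃ n : ℕ, P.trace = n := by
  classical
  have hlin : IsIdempotentElem (Matrix.toLin' P) := hP.map Matrix.toLinAlgEquiv'
  exact ⟨_, (Matrix.trace_toLin'_eq P).symm.trans
    (LinearMap.IsIdempotentElem.isProj_range _ hlin).trace⟩

variable [DecidableEq J]

theorem isIdempotentElem_of_mul_self_eq_smul_one [Field K] [NeZero (2 : K)] {r : K} (hr : r ≠ 0)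
    {M : Matrix J J K} (hM : M * M = (r * r) • 1) :
    IsIdempotentElem ((2⁻¹ : K) • (1 + r⁻¹ • M)) := by
  have involutive : (r⁻¹ • M) * (r⁻¹ • M) = 1 := by
    rw [smul_mul_smul_comm, hM, smul_smul, ← mul_inv, inv_mul_cancel₀ (mul_ne_zero hr hr), one_smul]
  rw [IsIdempotentElem, smul_mul_smul_comm, add_mul, mul_add, mul_add, involutive, one_mul,
    mul_one, one_mul]
  match_scalars <;> field_simp <;> ring

theorem conj_trace_of_mul_self_eq_smul_one {s : ℂ} (hs : s ≠ 0) {M : Matrix J J ℂ}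
    (hM : M * M = s • 1) : starRingEnd ℂ M.trace = ‖s‖ / s * M.trace := by
  obtain ⟨r, rfl⟩ := IsAlgClosed.exists_eq_mul_self s
  have hr : r ≠ 0 := left_ne_zero_of_mul hs
  obtain ⟨n, hn⟩ := exists_trace_eq_natCast (isIdempotentElem_of_mul_self_eq_smul_one hr hM)
  have trace_eq : M.trace = r * ((2 * n - Fintype.card J : ℝ) : ℂ) := by
    simp only [Matrix.trace_smul, Matrix.trace_add, Matrix.trace_one, smul_eq_mul] at hn
    push_cast
    rw [← hn]
    field_simp
    ring
  have conj_mul : starRingEnd ℂ r * r = ‖r‖ * ‖r‖ := by rw [Complex.conj_mul', sq]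
  rw [trace_eq, map_mul, Complex.conj_ofReal, norm_mul]
  push_cast
  rw [← conj_mul]
  field_simp

end Matrix

/-- A character and an eigenvector of the same structure constants pair nontrivially only if the
eigenvalues of the eigenvector are the values of the character. -/
theorem eq_of_fusion_relations {J R : Type*} [Fintype J] [CommRing R] [IsDomain R]
    {m : J → J → J → R} {x d e : J → R} (hx : ∀ y i, x y * x i = ∑ k, m y i k * x k)
    (hd : ∀ y k, d y * e k = ∑ i, e i * m y i k) (h0 : ∑ i, e i * x i ≠ 0) : x = d := by
  funext y
  apply mul_right_cancel₀ h0
  calc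
    x y * ∑ i, e i * x i = ∑ i, e i * (x y * x i) := by
      rw [Finset.mul_sum]
      exact Finset.sum_congr rfl fun i _ => by ring
    _ = ∑ k, ∑ i, e i * m y i k * x k := by
      simp only [hx, Finset.mul_sum, ← mul_assoc]
      exact Finset.sum_comm
    _ = d y * ∑ k, e k * x k := by
      simp only [← Finset.sum_mul, ← hd]
      simp only [mul_assoc, ← Finset.mul_sum]

section GlobalDimension

variable {C : Type u} [Category.{v} C] [Abelian C] [Linear ℂ C] [MonoidalCategory C]
  [MonoidalPreadditive C] [MonoidalLinear ℂ C] [RigidCategory C] [IsFusionCategory C]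
  [BraidedCategory C]

/-- The pairing `(Xᘁ, X)` obtained from the pairing `(X, Xᘁ)` and the braiding, with respect to
which the dimensions in a braided category are computed. -/
abbrev swapPairing (X : C) : ExactPairing Xᘁ X := BraidedCategory.exactPairing_swap X Xᘁ

attribute [local instance] swapPairing

theorem scalarOf_braidedTrace {X : C} [Simple X] (f : X ⟶ X) :
    scalarOf ℂ (𝟙_ C) (braidedTrace Xᘁ f) = scalarOf ℂ X f * dimRight X := by
  have trace_id : braidedTrace Xᘁ (𝟙 X) = η_ X Xᘁ ≫ ε_ Xᘁ X := by
    rw [braidedTrace, id_whiskerRight, Category.id_comp]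
    rfl
  conv_lhs => rw [← scalarOf_smul_id ℂ f, braidedTrace_smul, trace_id, map_smul]
  rfl

/-- The trace of the monodromy on the multiplicity space of `k` in `y ⊗ i`. -/
noncomputable def monodromyTrace (y i k : Irr C) : ℂ :=
  ∑ a, scalarOf ℂ k.obj ((decomp (y.obj ⊗ i.obj)).incl k a ≫ monodromy y.obj i.obj ≫
    (decomp (y.obj ⊗ i.obj)).proj k a)

theorem scalarOf_trace_isotypicProj (y i k : Irr C) :
    scalarOf ℂ (𝟙_ C) (braidedTrace y.objᘁ (partialTrace i.objᘁ
      ((isotypicProj k).app (y.obj ⊗ i.obj)))) = monodromyTrace y i k * dimRight k.obj := by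
  refine (congrArg _ (braidedTrace_comp_monodromy _).symm).trans ?_
  simp only [isotypicProj, Functor.id_obj]
  rw [Preadditive.sum_comp, braidedTrace_sum, map_sum, monodromyTrace, Finset.sum_mul]
  refine Finset.sum_congr rfl fun a _ => ?_
  rw [Category.assoc, braidedTrace_comm (Y' := k.objᘁ), scalarOf_braidedTrace, Category.assoc]

theorem dimRight_mul_dimRight (y i : Irr C) :
    dimRight y.obj * dimRight i.obj = ∑ k, monodromyTrace y i k * dimRight k.obj := by
  have total : ∑ k, (isotypicProj k).app (y.obj ⊗ i.obj) = 𝟙 (y.obj ⊗ i.obj) :=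
    (decomp (y.obj ⊗ i.obj)).total
  simp only [← scalarOf_trace_isotypicProj]
  rw [← map_sum, ← braidedTrace_sum, ← partialTrace_sum, total, partialTrace_id,
    braidedTrace_smul, map_smul, scalarOf_braidedTrace, scalarOf_id, smul_eq_mul]
  ring

theorem dimRight_mul_dimLeft (y k : Irr C) :
    dimRight y.obj * dimLeft k.obj = ∑ i, dimLeft i.obj * monodromyTrace y i k := by
  have h := congrArg (fun f => scalarOf ℂ (𝟙_ C) (braidedTrace y.objᘁ f))
    (sum_partialTrace_isotypicProj k y.obj)
  simp only [braidedTrace_sum, braidedTrace_smul, map_sum, map_smul, smul_eq_mul,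
    scalarOf_trace_isotypicProj, ← mul_assoc, ← Finset.sum_mul] at h
  rw [scalarOf_braidedTrace, scalarOf_id] at h
  apply mul_right_cancel₀ (dimRight_ne_zero k.obj)
  linear_combination -h

/-- The ratio of the right and the left dimension of a simple object; it measures the failure of the
chosen pairings to be pivotal, and plays the role of the square of a twist. -/
noncomputable def dimRatio (X : C) : ℂ := dimRight X / dimLeft X

theorem dimRatio_ne_zero (X : C) [Simple X] : dimRatio X ≠ 0 :=
  div_ne_zero (dimRight_ne_zero X) (dimLeft_ne_zero X)

theorem braiding_comp_evaluation (X : C) [Simple X] :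
    (β_ X Xᘁ).hom ≫ ε_ X Xᘁ = dimRatio X • ((β_ Xᘁ X).inv ≫ ε_ X Xᘁ) := by
  obtain ⟨c, hc⟩ : ∃ c : ℂ, (β_ X Xᘁ).hom ≫ ε_ X Xᘁ = c • ((β_ Xᘁ X).inv ≫ ε_ X Xᘁ) :=
    letI := reverseSwapPairing X Xᘁ
    eq_smul_evaluation_of_simple_right ℂ ((β_ X Xᘁ).hom ≫ ε_ X Xᘁ)
  have dimRight_eq : dimRight X = c * dimLeft X := by
    have circle : η_ X Xᘁ ≫ ε_ Xᘁ X = c • (η_ Xᘁ X ≫ ε_ X Xᘁ) := by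
      change η_ X Xᘁ ≫ (β_ X Xᘁ).hom ≫ ε_ X Xᘁ = c • ((η_ X Xᘁ ≫ (β_ Xᘁ X).inv) ≫ ε_ X Xᘁ)
      rw [hc, Linear.comp_smul, Category.assoc]
    rw [dimRight, circle, map_smul, smul_eq_mul, dimLeft]
  rw [dimRatio, dimRight_eq, mul_div_cancel_right₀ _ (dimLeft_ne_zero X), hc]

theorem braidedTrace_eq_smul_reverseTrace {X : C} [Simple X] (f : X ⟶ X) :
    braidedTrace Xᘁ f = dimRatio X • reverseTrace Xᘁ f := by
  rw [reverseTrace, braidedTrace, braiding_comp_evaluation, Linear.comp_smul, Linear.comp_smul]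

theorem partialTrace_eq_smul_reversePartialTrace {V W X : C} [Simple X] (φ : V ⊗ X ⟶ W ⊗ X) :
    partialTrace Xᘁ φ = dimRatio X • reversePartialTrace Xᘁ φ := by
  change (ρ_ V).inv ≫ V ◁ η_ X Xᘁ ≫ (α_ V X Xᘁ).inv ≫ φ ▷ Xᘁ ≫ (α_ W X Xᘁ).hom ≫
      W ◁ ((β_ X Xᘁ).hom ≫ ε_ X Xᘁ) ≫ (ρ_ W).hom =
    dimRatio X • ((ρ_ V).inv ≫ V ◁ η_ X Xᘁ ≫ (α_ V X Xᘁ).inv ≫ φ ▷ Xᘁ ≫ (α_ W X Xᘁ).hom ≫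
      W ◁ ((β_ Xᘁ X).inv ≫ ε_ X Xᘁ) ≫ (ρ_ W).hom)
  rw [braiding_comp_evaluation]
  simp

theorem scalarOf_monodromy_sq {y i k : C} [Simple y] [Simple i] [Simple k] (f : y ⊗ i ⟶ k)
    (g : k ⟶ y ⊗ i) :
    scalarOf ℂ k (g ≫ monodromy y i ≫ monodromy y i ≫ f) =
      dimRatio y * dimRatio i / dimRatio k * scalarOf ℂ k (g ≫ f) := by
  have trace_eq : braidedTrace kᘁ (g ≫ monodromy y i ≫ monodromy y i ≫ f) =
      (dimRatio y * dimRatio i) • reverseTrace kᘁ (g ≫ f) := by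
    calc
      _ = braidedTrace (iᘁ ⊗ yᘁ) ((f ≫ g ≫ monodromy y i) ≫ monodromy y i) := by
        conv_rhs => rw [Category.assoc, braidedTrace_comm (Y' := kᘁ)]
        simp only [Category.assoc]
      _ = (dimRatio y * dimRatio i) •
          reverseTrace yᘁ (reversePartialTrace iᘁ (f ≫ g ≫ monodromy y i)) := by
        rw [braidedTrace_comp_monodromy, braidedTrace_eq_smul_reverseTrace,
          partialTrace_eq_smul_reversePartialTrace, reverseTrace_smul, smul_smul]
      _ = _ := by
        rw [← reverseTrace_comp_inv_monodromy, Category.assoc, reverseTrace_comm (Y' := kᘁ)]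
        simp
  have trace_comp : scalarOf ℂ k (g ≫ f) * dimRight k =
      dimRatio k * scalarOf ℂ (𝟙_ C) (reverseTrace kᘁ (g ≫ f)) := by
    rw [← scalarOf_braidedTrace, braidedTrace_eq_smul_reverseTrace, map_smul, smul_eq_mul]
  have := dimRatio_ne_zero k
  apply mul_right_cancel₀ (dimRight_ne_zero k)
  rw [← scalarOf_braidedTrace, trace_eq, map_smul, smul_eq_mul, mul_assoc _ _ (dimRight k),
    trace_comp]
  field_simp

theorem conj_monodromyTrace (y i k : Irr C) :
    starRingEnd ℂ (monodromyTrace y i k) =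
      ‖dimRatio y.obj * dimRatio i.obj / dimRatio k.obj‖ /
        (dimRatio y.obj * dimRatio i.obj / dimRatio k.obj) * monodromyTrace y i k := by
  let d := decomp (y.obj ⊗ i.obj)
  let M : Matrix (d.idx k) (d.idx k) ℂ := Matrix.of fun a b =>
    scalarOf ℂ k.obj (d.incl k a ≫ monodromy y.obj i.obj ≫ d.proj k b)
  refine conj_trace_of_mul_self_eq_smul_one (M := M)
    (div_ne_zero (mul_ne_zero (dimRatio_ne_zero _) (dimRatio_ne_zero _)) (dimRatio_ne_zero _)) ?_
  ext a b
  calc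
    (M * M) a b = scalarOf ℂ k.obj
        (d.incl k a ≫ monodromy y.obj i.obj ≫ monodromy y.obj i.obj ≫ d.proj k b) := by
      conv_rhs => rw [← Category.assoc, d.hom_eq_sum (𝕜 := ℂ) (d.incl k a ≫ monodromy _ _)]
      simp [M, Matrix.mul_apply, Preadditive.sum_comp]
    _ = _ := by
      rw [scalarOf_monodromy_sq, d.incl_proj, Matrix.smul_apply, Matrix.one_apply, smul_eq_mul]
      split_ifs <;> simp

/-- The complex conjugate of the right dimension, corrected by a phase so as to satisfy the same
fusion relations as `dimRight`. -/
noncomputable def conjDim (X : C) : ℂ :=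
  starRingEnd ℂ (dimRight X) * dimRatio X / ‖dimRatio X‖

theorem conjDim_mul_conjDim (y i : Irr C) :
    conjDim y.obj * conjDim i.obj = ∑ k, monodromyTrace y i k * conjDim k.obj := by
  have dimRatio_ne (k : Irr C) := dimRatio_ne_zero k.obj
  have norm_ne (k : Irr C) : (‖dimRatio k.obj‖ : ℂ) ≠ 0 := by simpa using dimRatio_ne k
  have conj_relation := congrArg (starRingEnd ℂ) (dimRight_mul_dimRight y i)
  simp only [map_mul, map_sum, conj_monodromyTrace] at conj_relation
  calc
    _ = (dimRatio y.obj * dimRatio i.obj / (‖dimRatio y.obj‖ * ‖dimRatio i.obj‖)) *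
        (starRingEnd ℂ (dimRight y.obj) * starRingEnd ℂ (dimRight i.obj)) := by
      simp only [conjDim]
      ring
    _ = _ := by
      rw [conj_relation, Finset.mul_sum]
      refine Finset.sum_congr rfl fun k _ => ?_
      have := dimRatio_ne y; have := dimRatio_ne i; have := dimRatio_ne k
      have := norm_ne y; have := norm_ne i; have := norm_ne k
      simp only [conjDim, norm_mul, norm_div, Complex.ofReal_mul, Complex.ofReal_div]
      field_simp

theorem dimLeft_mul_conjDim (X : C) [Simple X] :
    dimLeft X * conjDim X = ((‖dimRight X‖ ^ 2 / ‖dimRatio X‖ : ℝ) : ℂ) := by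
  have dimLeft_mul_dimRatio : dimLeft X * dimRatio X = dimRight X :=
    mul_div_cancel₀ _ (dimLeft_ne_zero X)
  push_cast
  rw [← Complex.mul_conj', conjDim]
  linear_combination (starRingEnd ℂ (dimRight X) / ‖dimRatio X‖) * dimLeft_mul_dimRatio

variable (C) in
theorem sum_dimLeft_mul_conjDim_ne_zero : ∑ i : Irr C, dimLeft i.obj * conjDim i.obj ≠ 0 := by
  simp only [dimLeft_mul_conjDim]
  rw [← Complex.ofReal_sum, Complex.ofReal_ne_zero]
  obtain ⟨o, -⟩ := Irr.exists_iso (𝟙_ C)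
  refine (Finset.sum_pos (fun i _ => ?_) ⟨o, Finset.mem_univ o⟩).ne'
  have := norm_pos_iff.2 (dimRight_ne_zero i.obj)
  have := norm_pos_iff.2 (dimRatio_ne_zero i.obj)
  positivity

variable (C) in
theorem sum_dimLeft_mul_dimRight_ne_zero : ∑ i : Irr C, dimLeft i.obj * dimRight i.obj ≠ 0 := by
  have conjDim_eq : (fun i : Irr C => conjDim i.obj) = fun i => dimRight i.obj :=
    eq_of_fusion_relations conjDim_mul_conjDim dimRight_mul_dimLeft
      (sum_dimLeft_mul_conjDim_ne_zero C)
  simpa only [congrFun conjDim_eq] using sum_dimLeft_mul_conjDim_ne_zero C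

end GlobalDimension

/-! ### Monoidal automorphisms of the identity are ring operators -/

section Invertible

variable {C : Type u} [Category.{v} C] [MonoidalCategory C]

theorem InvObj.simple [Limits.HasZeroMorphisms C] [Simple (𝟙_ C)] (a : InvObj C) :
    Simple a.obj := by
  have := a.isEquivalence_tensorLeft
  have : Simple (a.obj ⊗ 𝟙_ C) := simple_obj (tensorLeft a.obj) (𝟙_ C)
  exact Simple.of_iso (ρ_ a.obj).symm

theorem pi2_ext [Abelian C] [Linear ℂ C] [BraidedCategory C] {s t : Pi2 (BrAut C)}
    (h : ∀ X, pi2App s X = pi2App t X) : s = t := Iso.ext (BrAut.hom_ext h)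

end Invertible

section Transparent

variable {C : Type u} [Category.{v} C] [MonoidalCategory C] [BraidedCategory C]

theorem transparent_unit (y : C) : Transparent (𝟙_ C) y := by simp [Transparent, monodromy]

theorem Transparent.of_retraction {k X y : C} (h : Transparent X y) {x : k ⟶ X} {s : X ⟶ k}
    (hs : x ≫ s = 𝟙 k) : Transparent k y := by
  have slide := monodromy_naturality_left x y =≫ s ▷ y
  rw [show monodromy X y = 𝟙 _ from h, Category.comp_id, Category.assoc, ← comp_whiskerRight, hs,
    id_whiskerRight, Category.comp_id] at slide
  exact slide.symm

/-- If `c` has monodromy `t` with `y`, then its dual has the inverse monodromy. -/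
theorem transparent_tensor_dual {c c' y : C} [ExactPairing c c'] {t : y ⟶ y}
    (h : monodromy c y = c ◁ t) : Transparent (c ⊗ c') y := by
  have monodromy_tensor : monodromy (c ⊗ c') y =
      (α_ c c' y).hom ≫ c ◁ (monodromy c' y ≫ c' ◁ t) ≫ (α_ c c' y).inv := by
    calc
      _ = (α_ c c' y).hom ≫ c ◁ ((β_ c' y).hom ≫ t ▷ c' ≫ (β_ y c').hom) ≫ (α_ c c' y).inv := by
        rw [monodromy_tensor_left, h]
        monoidal
      _ = _ := by
        rw [BraidedCategory.braiding_naturality_left]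
        simp [monodromy]
  have monodromy_dual : monodromy c' y ≫ c' ◁ t = 𝟙 (c' ⊗ y) := by
    have slide := monodromy_naturality_left (η_ c c') y
    rw [monodromy_tensor, show monodromy (𝟙_ C) y = 𝟙 _ from transparent_unit y,
      Category.id_comp] at slide
    apply (tensorLeftHomEquiv y c c' (c' ⊗ y)).injective
    change (λ_ _).inv ≫ η_ c c' ▷ _ ≫ (α_ _ _ _).hom ≫ c ◁ (monodromy c' y ≫ c' ◁ t) =
      (λ_ _).inv ≫ η_ c c' ▷ _ ≫ (α_ _ _ _).hom ≫ c ◁ (𝟙 (c' ⊗ y))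
    rw [cancel_epi, ← cancel_mono (α_ c c' y).inv]
    simpa using slide
  rw [Transparent, monodromy_tensor, monodromy_dual]
  simp

theorem exists_invObj_of_tensor_iso_unit {c c' : C} (e : c ⊗ c' ≅ 𝟙_ C) :
    ∃ a : InvObj C, toSkeleton c = (a : Skeleton C) :=
  ⟨{ val := toSkeleton c
     inv := toSkeleton c'
     val_inv := by
      rw [← Skeleton.toSkeleton_tensorObj, Skeleton.one_eq]
      exact congr_toSkeleton_of_iso e
     inv_val := by
      rw [← Skeleton.toSkeleton_tensorObj, Skeleton.one_eq]
      exact congr_toSkeleton_of_iso (β_ _ _ ≪≫ e) }, rfl⟩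

/-- The monodromy of `c` followed by a natural endomorphism of the encircling strand. -/
def twistedMonodromy (c : C) (θ : 𝟭 C ⟶ 𝟭 C) : tensorLeft c ⟶ tensorLeft c where
  app X := monodromy c X ≫ c ◁ θ.app X
  naturality X Y f := by
    have h : f ≫ θ.app Y = θ.app X ≫ f := θ.naturality f
    have h' := monodromy_naturality_right c f
    simp only [curriedTensor_obj_map]
    rw [← Category.assoc, h', Category.assoc, Category.assoc, ← MonoidalCategory.whiskerLeft_comp,
      ← MonoidalCategory.whiskerLeft_comp, h]

theorem twistedMonodromy_app (c : C) (θ : 𝟭 C ⟶ 𝟭 C) (X : C) :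
    (twistedMonodromy c θ).app X = monodromy c X ≫ c ◁ θ.app X := rfl

theorem twistedMonodromy_app_tensor (c : C) (θ : 𝟭 C ⟶ 𝟭 C) [NatTrans.IsMonoidal θ] (y X : C) :
    (α_ c y X).hom ≫ (twistedMonodromy c θ).app (y ⊗ X) ≫ (α_ c y X).inv =
      (β_ c y).hom ▷ X ≫ ((α_ y c X).hom ≫ y ◁ (twistedMonodromy c θ).app X ≫ (α_ y c X).inv) ≫
        ((β_ y c).hom ≫ c ◁ θ.app y) ▷ X := by
  have slide (u : y ⟶ y) (v : X ⟶ X) :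
      (α_ c y X).hom ≫ (monodromy c (y ⊗ X) ≫ c ◁ (u ⊗ₘ v)) ≫ (α_ c y X).inv =
        (β_ c y).hom ▷ X ≫ ((α_ y c X).hom ≫ y ◁ (monodromy c X ≫ c ◁ v) ≫ (α_ y c X).inv) ≫
          ((β_ y c).hom ≫ c ◁ u) ▷ X := by
    calc
      _ = (β_ c y).hom ▷ X ≫ (α_ y c X).hom ≫ y ◁ monodromy c X ⊗≫
          ((β_ y c).hom ≫ c ◁ u) ▷ X ≫ (c ⊗ y) ◁ v := by
        rw [MonoidalCategory.tensorHom_def, monodromy_tensor_right]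
        monoidal
      _ = _ := by
        rw [← whisker_exchange]
        monoidal
  have θ_tensor : θ.app (y ⊗ X) = θ.app y ⊗ₘ θ.app X := by
    simpa using NatTrans.IsMonoidal.tensor (τ := θ) y X
  rw [twistedMonodromy_app, θ_tensor]
  exact slide (θ.app y) (θ.app X)

end Transparent

section RingOperator

variable {C : Type u} [Category.{v} C] [Abelian C] [Linear ℂ C] [MonoidalCategory C]
  [MonoidalPreadditive C] [MonoidalLinear ℂ C] [RigidCategory C] [IsFusionCategory C]
  [BraidedCategory C]

section Average

attribute [local instance] swapPairing

theorem twistedMonodromy_comp_integral (c y : C) (θ : 𝟭 C ⟶ 𝟭 C) [NatTrans.IsMonoidal θ] :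
    (twistedMonodromy c θ).app y ≫ integral (twistedMonodromy c θ) ▷ y =
      integral (twistedMonodromy c θ) ▷ y := by
  have slide_summand (X : C) : partialTrace Xᘁ
      ((α_ c y X).hom ≫ (twistedMonodromy c θ).app (y ⊗ X) ≫ (α_ c y X).inv) =
      (β_ c y).hom ≫ y ◁ partialTrace Xᘁ ((twistedMonodromy c θ).app X) ≫
        (β_ y c).hom ≫ c ◁ θ.app y := by
    rw [twistedMonodromy_app_tensor, comp_partialTrace, partialTrace_comp,
      ← whiskerLeft_partialTrace]
  have slide : integral ((tensorLeftTensor c y).hom ≫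
      Functor.whiskerLeft (tensorLeft y) (twistedMonodromy c θ) ≫ (tensorLeftTensor c y).inv) =
      (β_ c y).hom ≫ y ◁ integral (twistedMonodromy c θ) ≫ (β_ y c).hom ≫ c ◁ θ.app y := by
    refine (Finset.sum_congr rfl fun i _ =>
      congrArg (dimLeft i.obj • ·) (slide_summand i.obj)).trans ?_
    simp only [integral, whiskerLeft_sum, MonoidalLinear.whiskerLeft_smul,
      Preadditive.comp_sum, Preadditive.sum_comp, Linear.comp_smul, Linear.smul_comp]
  refine Eq.trans ?_ (integral_tensorLeftTensor (twistedMonodromy c θ) y)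
  rw [slide, BraidedCategory.braiding_naturality_right_assoc, ← whisker_exchange]
  simp [twistedMonodromy_app, monodromy]

theorem integral_twistedMonodromy_eq_zero {c : C} [Simple c] {θ : 𝟭 C ⟶ 𝟭 C}
    [NatTrans.IsMonoidal θ] (h : twistedMonodromy c θ ≠ 𝟙 _) :
    integral (twistedMonodromy c θ) = 0 := by
  contrapose! h
  ext y
  have : IsIso (integral (twistedMonodromy c θ)) := isIso_of_hom_simple h
  exact (cancel_mono (integral (twistedMonodromy c θ) ▷ y)).1
    ((twistedMonodromy_comp_integral c y θ).trans (Category.id_comp _).symm)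

/-- The invariant of the Hopf link coloured by `c` and `i`: an entry of the S-matrix, with respect
to the chosen pairings. -/
noncomputable def hopfLink (c i : C) : ℂ :=
  scalarOf ℂ (𝟙_ C) (braidedTrace cᘁ (partialTrace iᘁ (monodromy c i)))

theorem hopfLink_comm (c i : C) : hopfLink c i = hopfLink i c :=
  congrArg (scalarOf ℂ (𝟙_ C)) (trace_partialTrace_monodromy_comm c i cᘁ iᘁ)

theorem hopfLink_of_iso_unit {o : C} [Simple o] (e : 𝟙_ C ≅ o) (c : C) :
    hopfLink o c = dimRight c * dimRight o := by
  have h : monodromy o c = 𝟙 _ := Transparent.of_iso e (transparent_unit c)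
  rw [hopfLink, h, partialTrace_id, braidedTrace_smul, map_smul, smul_eq_mul,
    scalarOf_braidedTrace, scalarOf_id, one_mul]

theorem sum_dimLeft_mul_hopfLink_eq_zero {c : C} [Simple c] {θ : 𝟭 C ⟶ 𝟭 C}
    [NatTrans.IsMonoidal θ] (h : twistedMonodromy c θ ≠ 𝟙 _) :
    ∑ i : Irr C, dimLeft i.obj * scalarOf ℂ i.obj (θ.app i.obj) * hopfLink c i.obj = 0 := by
  have app_eq_smul (i : Irr C) : (twistedMonodromy c θ).app i.obj =
      scalarOf ℂ i.obj (θ.app i.obj) • monodromy c i.obj := by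
    rw [twistedMonodromy_app]
    conv_lhs => rw [← scalarOf_smul_id ℂ (X := i.obj) (θ.app i.obj)]
    simp
  have summand (i : Irr C) : partialTrace i.objᘁ ((twistedMonodromy c θ).app i.obj) =
      scalarOf ℂ i.obj (θ.app i.obj) • partialTrace i.objᘁ (monodromy c i.obj) :=
    (congrArg (partialTrace i.objᘁ) (app_eq_smul i)).trans (partialTrace_smul ..)
  have trace_integral := congrArg (fun f => scalarOf ℂ (𝟙_ C) (braidedTrace cᘁ f))
    (integral_twistedMonodromy_eq_zero h)
  simp only [integral, summand, smul_smul, braidedTrace_sum, braidedTrace_smul, map_sum,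
    map_smul, smul_eq_mul] at trace_integral
  refine trace_integral.trans ?_
  simp [braidedTrace]

variable [IsNondegenerate C]

theorem sum_dimLeft_mul_hopfLink_eq_zero_of_not_iso_unit {c : C} [Simple c]
    (h : IsEmpty (c ≅ 𝟙_ C)) : ∑ i : Irr C, dimLeft i.obj * hopfLink c i.obj = 0 := by
  have hc : twistedMonodromy c (𝟙 (𝟭 C)) ≠ 𝟙 _ := fun hc =>
    not_nonempty_iff.2 h (IsNondegenerate.iso_unit c inferInstance fun y => by
      simpa [twistedMonodromy_app, Transparent] using NatTrans.congr_app hc y)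
  simpa using sum_dimLeft_mul_hopfLink_eq_zero hc

/-- Otherwise `hopfLink` would have a kernel, which nondegeneracy and the nonvanishing of the global
dimension exclude. -/
theorem exists_twistedMonodromy_eq_id (θ : 𝟭 C ⟶ 𝟭 C) [NatTrans.IsMonoidal θ] :
    ∃ c : Irr C, twistedMonodromy c.obj θ = 𝟙 _ := by
  by_contra! H
  obtain ⟨o, ⟨e⟩⟩ := Irr.exists_iso (𝟙_ C)
  let w (i : Irr C) : ℂ := scalarOf ℂ i.obj (θ.app i.obj)
  have sum_of_ne (i : Irr C) (hi : i ≠ o) :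
      ∑ c : Irr C, dimLeft c.obj * hopfLink i.obj c.obj = 0 :=
    sum_dimLeft_mul_hopfLink_eq_zero_of_not_iso_unit ⟨fun e' => hi (Irr.eq_of_iso (e' ≪≫ e))⟩
  have sum_unit : ∑ c : Irr C, dimLeft c.obj * hopfLink o.obj c.obj =
      (∑ c : Irr C, dimLeft c.obj * dimRight c.obj) * dimRight o.obj := by
    simp only [hopfLink_of_iso_unit e, Finset.sum_mul, mul_assoc]
  have double_sum : ∑ i : Irr C, dimLeft i.obj * w i *
      ∑ c : Irr C, dimLeft c.obj * hopfLink i.obj c.obj = 0 := by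
    calc
      _ = ∑ c : Irr C, dimLeft c.obj *
          ∑ i : Irr C, dimLeft i.obj * w i * hopfLink c.obj i.obj := by
        simp only [Finset.mul_sum]
        rw [Finset.sum_comm]
        refine Finset.sum_congr rfl fun c _ => Finset.sum_congr rfl fun i _ => ?_
        rw [hopfLink_comm c.obj i.obj]
        ring
      _ = 0 := by simp [w, sum_dimLeft_mul_hopfLink_eq_zero (H _)]
  have w_unit : w o ≠ 0 := by
    have θ_unit : θ.app (𝟙_ C) = 𝟙 _ := by simpa using NatTrans.IsMonoidal.unit (τ := θ)
    have θ_naturality : θ.app (𝟙_ C) ≫ e.hom = e.hom ≫ θ.app o.obj := (θ.naturality e.hom).symm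
    rw [θ_unit, ← scalarOf_smul_id ℂ (X := o.obj) (θ.app o.obj)] at θ_naturality
    intro (hw : scalarOf ℂ o.obj (θ.app o.obj) = 0)
    rw [hw, zero_smul, Limits.comp_zero] at θ_naturality
    exact id_nonzero (𝟙_ C) ((cancel_mono e.hom).1 (θ_naturality.trans Limits.zero_comp.symm))
  rw [Finset.sum_eq_single o (fun i _ hi => by rw [sum_of_ne i hi, mul_zero]) (by simp),
    sum_unit] at double_sum
  exact mul_ne_zero (mul_ne_zero (dimLeft_ne_zero _) w_unit)
    (mul_ne_zero (sum_dimLeft_mul_dimRight_ne_zero C) (dimRight_ne_zero _)) double_sum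

end Average

theorem tensor_dual_iso_unit [IsNondegenerate C] {c c' : C} [ExactPairing c c'] [Simple c]
    (h : ∀ y, Transparent (c ⊗ c') y) : Nonempty (c ⊗ c' ≅ 𝟙_ C) := by
  obtain ⟨r, hr⟩ := (decomp (c ⊗ c')).exists_retraction coevaluation_ne_zero
  refine ⟨⟨r, η_ c c', (decomp (c ⊗ c')).hom_ext fun k x => ?_, hr⟩⟩
  by_cases hx : x = 0
  · simp [hx]
  obtain ⟨s, hs⟩ := (decomp (c ⊗ c')).exists_retraction hx
  obtain ⟨e⟩ := IsNondegenerate.iso_unit k.obj inferInstance fun y => (h y).of_retraction hs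
  obtain ⟨z, hz⟩ := eq_smul_coevaluation_of_simple ℂ (e.inv ≫ x)
  rw [← cancel_epi e.inv, ← Category.assoc, hz]
  simp [reassoc_of% hr, hz]

theorem ringOperator_surjective [IsNondegenerate C] :
    Function.Surjective (ringOperator : InvObj C →* Pi2 (BrAut C)) := by
  intro t
  let θ : 𝟭 C ⟶ 𝟭 C := t⁻¹.hom.iso.hom
  have : NatTrans.IsMonoidal θ := t⁻¹.hom.isMonoidal
  have inv_comp (X : C) : pi2App t⁻¹ X ≫ pi2App t X = 𝟙 X :=
    congrArg (fun s : Pi2 (BrAut C) => pi2App s X) (mul_inv_cancel t)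
  obtain ⟨c, hc⟩ := exists_twistedMonodromy_eq_id θ
  have monodromy_comp (X : C) : monodromy c.obj X ≫ c.obj ◁ pi2App t⁻¹ X = 𝟙 _ :=
    NatTrans.congr_app hc X
  have monodromy_eq (X : C) : monodromy c.obj X = c.obj ◁ pi2App t X := by
    simpa [← MonoidalCategory.whiskerLeft_comp, inv_comp]
      using monodromy_comp X =≫ c.obj ◁ pi2App t X
  obtain ⟨e⟩ := tensor_dual_iso_unit (c := c.obj) (c' := c.objᘁ) fun X =>
    transparent_tensor_dual (monodromy_eq X)
  obtain ⟨a, ha⟩ := exists_invObj_of_tensor_iso_unit e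
  exact ⟨a, pi2_ext fun X => (eq_ringIso a ha (monodromy_eq X).symm).symm⟩

theorem ringOperator_injective [IsNondegenerate C] :
    Function.Injective (ringOperator : InvObj C →* Pi2 (BrAut C)) := by
  rw [injective_iff_map_eq_one]
  intro a ha
  obtain ⟨e⟩ := IsNondegenerate.iso_unit a.obj a.simple fun Y =>
    (transparent_iff_ringIso a a.toSkeleton_obj Y).2
      (congrArg (fun s : Pi2 (BrAut C) => pi2App s Y) ha)
  exact Units.ext (a.toSkeleton_obj.symm.trans (congr_toSkeleton_of_iso e))

end RingOperator

/-! ### Exactness -/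

section Exactness

variable {C : Type u} [Category.{v} C] [Abelian C] [Linear ℂ C] [MonoidalCategory C]
  [BraidedCategory C] {A : Mon C}

theorem one_lam : (𝟙_ (BrAutOver A)).lam = 𝟙 A.X := BrAutOver.ofAut_lam 1

theorem pi2App_map_forget (t : Pi2 (BrAutOver A)) (X : C) :
    pi2App (Pi2.map (BrAutOver.forget A) t) X = t.hom.toHom.iso.hom.app X := by
  have h := Iso.conjAut_apply (Functor.Monoidal.εIso (BrAutOver.forget A)).symm
    ((BrAutOver.forget A).mapAut (𝟙_ (BrAutOver A)) t)
  exact (congrArg (fun s : Pi2 (BrAut C) => pi2App s X) h).trans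
    ((Category.id_comp _).trans (Category.comp_id _))

theorem map_forget_injective : Function.Injective (Pi2.map (BrAutOver.forget A)) := by
  intro s t h
  refine Iso.ext (BrAutOver.Hom.ext (BrAut.hom_ext fun X => ?_))
  rw [← pi2App_map_forget, ← pi2App_map_forget, h]

variable (A)

theorem mem_ker_evalAt {t : Pi2 (BrAut C)} : t ∈ (evalAt A).ker ↔ pi2App t A.X = 𝟙 A.X :=
  ⟨fun h => congrArg (fun l : Aut A => l.hom.hom) h, fun h => Iso.ext (Mon.Hom.ext h)⟩

theorem range_map_forget : (Pi2.map (BrAutOver.forget A)).range = (evalAt A).ker := by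
  ext t
  rw [mem_ker_evalAt]
  constructor
  · rintro ⟨s, rfl⟩
    have comm := s.hom.comm
    rw [one_lam] at comm
    rw [pi2App_map_forget]
    exact (Category.comp_id _).symm.trans comm
  · intro ht
    have comm : t.hom.iso.hom.app A.X ≫ (𝟙_ (BrAutOver A)).lam = (𝟙_ (BrAutOver A)).lam := by
      rw [one_lam]
      exact (Category.comp_id _).trans ht
    exact ⟨BrAutOver.isoOfHom ⟨t.hom, comm⟩, pi2_ext fun X => pi2App_map_forget _ X⟩

theorem ker_sigma : (sigma A).ker = transparentSubgroup A.X := by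
  ext a
  exact (mem_ker_evalAt A).trans
    ⟨fun h _ hx => (transparent_iff_ringIso a hx A.X).2 h,
      fun h => (transparent_iff_ringIso a a.toSkeleton_obj A.X).1 (h _ a.toSkeleton_obj)⟩

theorem ker_autToPi1 : (autToPi1 A).ker = (evalAt A).range := by
  ext l
  constructor
  · intro h
    obtain e : BrAutOver.ofAut l ≅ 𝟙_ (BrAutOver A) := Skeleton.isoOfEq h
    refine ⟨BrAut.isoOfHom e.hom.toHom, Iso.ext (Mon.Hom.ext ?_)⟩
    have comm := e.hom.comm
    rw [one_lam, BrAutOver.ofAut_lam] at comm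
    exact (Category.comp_id _).symm.trans comm
  · rintro ⟨t, rfl⟩
    refine congr_toSkeleton_of_iso (BrAutOver.isoOfHom (F := BrAutOver.ofAut (evalAt A t))
      (G := 𝟙_ (BrAutOver A)) ⟨t.hom, ?_⟩)
    rw [one_lam, BrAutOver.ofAut_lam]
    exact Category.comp_id _

theorem ker_map_toStab : (Pi1.map (toStab A)).ker = (autToPi1 A).range := by
  ext x
  constructor
  · intro h
    induction x using Quotient.inductionOn with
    | h F =>
    change Pi1.map (toStab A) (toSkeleton F) = toSkeleton (𝟙_ (Stab A)) at h
    rw [Pi1.map_toSkeleton] at h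
    obtain e : (toStab A).obj F ≅ 𝟙_ (Stab A) := Skeleton.isoOfEq h
    let f : 𝟙_ (BrAut C) ⟶ F.aut := e.inv.hom
    let l : Aut A :=
      Functor.mapMonIdIso.symm.app A ≪≫ (Functor.mapMonNatIso f.iso).app A ≪≫ F.algIso
    have l_hom : l.hom.hom = f.iso.hom.app A.X ≫ F.lam := Category.id_comp _
    refine ⟨l, congr_toSkeleton_of_iso (BrAutOver.isoOfHom (F := BrAutOver.ofAut l) (G := F)
      ⟨f, ?_⟩)⟩
    rw [BrAutOver.ofAut_lam, l_hom]
    rfl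
  · rintro ⟨l, rfl⟩
    change Pi1.map (toStab A) (toSkeleton (BrAutOver.ofAut l)) = toSkeleton (𝟙_ (Stab A))
    rw [Pi1.map_toSkeleton]
    rfl

theorem map_toStab_surjective : Function.Surjective (Pi1.map (toStab A)) := by
  intro x
  induction x using Quotient.inductionOn with
  | h F =>
  obtain ⟨F, ⟨f⟩⟩ := F
  exact ⟨toSkeleton (⟨F, f⟩ : BrAutOver A), Pi1.map_toSkeleton _ _⟩

theorem range_sigma (hσ : Function.Surjective (ringOperator : InvObj C →* Pi2 (BrAut C))) :
    (sigma A).range = (evalAt A).range := by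
  rw [sigma, MonoidHom.range_comp, MonoidHom.range_eq_top.2 hσ, ← MonoidHom.range_eq_map]

theorem exists_pi2_mulEquiv_transparentSubgroup
    (hσ : Function.Bijective (ringOperator : InvObj C →* Pi2 (BrAut C))) :
    ∃ e : Pi2 (BrAutOver A) ≃* transparentSubgroup A.X, ∀ t : Pi2 (BrAutOver A),
      ringOperator (e t : InvObj C) = Pi2.map (BrAutOver.forget A) t := by
  have map_transparentSubgroup : (transparentSubgroup A.X).map ringOperator =
      (Pi2.map (BrAutOver.forget A)).range := by
    rw [range_map_forget, ← ker_sigma, sigma, ← MonoidHom.comap_ker,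
      Subgroup.map_comap_eq_self_of_surjective hσ.2]
  let e := ((MonoidHom.ofInjective (map_forget_injective (A := A))).trans
    (MulEquiv.subgroupCongr map_transparentSubgroup.symm)).trans
      ((transparentSubgroup A.X).equivMapOfInjective _ hσ.1).symm
  refine ⟨e, fun t => ?_⟩
  rw [← Subgroup.coe_equivMapOfInjective_apply _ _ hσ.1]
  simp only [e, MulEquiv.trans_apply, MulEquiv.apply_symm_apply]
  rfl

end Exactness

theorem mainTheorem6_general {C : Type u} [Category.{v} C] [Abelian C] [Linear ℂ C]
    [MonoidalCategory C] [MonoidalPreadditive C] [MonoidalLinear ℂ C] [RigidCategory C]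
    [BraidedCategory C] [IsFusionCategory C] [IsNondegenerate C] (A : Mon C) :
    Function.Bijective (ringOperator : InvObj C →* Pi2 (BrAut C)) ∧
    (∃ e : Pi2 (BrAutOver A) ≃* transparentSubgroup A.X,
      ∀ t : Pi2 (BrAutOver A),
        ringOperator (e t : InvObj C) = Pi2.map (BrAutOver.forget A) t) ∧
    Function.Injective (transparentSubgroup A.X).subtype ∧
    Function.MulExact (transparentSubgroup A.X).subtype (sigma A) ∧
    Function.MulExact (sigma A) (autToPi1 A) ∧
    Function.MulExact (autToPi1 A) (Pi1.map (toStab A)) ∧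
    Function.Surjective (Pi1.map (toStab A)) := by
  have hσ : Function.Bijective (ringOperator : InvObj C →* Pi2 (BrAut C)) :=
    ⟨ringOperator_injective, ringOperator_surjective⟩
  refine ⟨hσ, exists_pi2_mulEquiv_transparentSubgroup A hσ, Subgroup.subtype_injective _,
    MonoidHom.mulExact_iff.2 ?_, MonoidHom.mulExact_iff.2 ?_,
    MonoidHom.mulExact_iff.2 (ker_map_toStab A), map_toStab_surjective A⟩
  · rw [ker_sigma, Subgroup.range_subtype]
  · rw [ker_autToPi1, range_sigma A hσ.surjective]

theorem mainTheorem6 {C : Type u} [Category.{v} C] [Abelian C] [Linear ℂ C] [MonoidalCategory C]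
    [MonoidalPreadditive C] [MonoidalLinear ℂ C] [RigidCategory C] [BraidedCategory C]
    [IsFusionCategory C] [IsNondegenerate C] (A : Mon C) [IsConnectedEtale A] :
    -- the ring operators give an isomorphism of `Inv(C)` with `π₂` of the categorical group of
    -- braided autoequivalences, under which `π₂` of the one over `A` is `A' ∩ Inv(C)`
    Function.Bijective (ringOperator : InvObj C →* Pi2 (BrAut C)) ∧
    (∃ e : Pi2 (BrAutOver A) ≃* transparentSubgroup A.X,
      ∀ t : Pi2 (BrAutOver A),
        ringOperator (e t : InvObj C) = Pi2.map (BrAutOver.forget A) t) ∧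
    -- the exact sequence of groups
    Function.Injective (transparentSubgroup A.X).subtype ∧
    Function.MulExact (transparentSubgroup A.X).subtype (sigma A) ∧
    Function.MulExact (sigma A) (autToPi1 A) ∧
    Function.MulExact (autToPi1 A) (Pi1.map (toStab A)) ∧
    Function.Surjective (Pi1.map (toStab A)) :=
  mainTheorem6_general A
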